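/- Let $K$ be an imaginary quadratic field, regarded as a subfield of $\mathbb{C}$, let $\mathcal{O}$ be an order in $K$ of discriminant $D=D_\mathcal{O}$, and let $N$ be a positive integer. Let $I(\mathcal{O})$ be the group of proper (equivalently, invertible) fractional $\mathcal{O}$-ideals, $I(\mathcal{O},N)$ its subgroup generated by the nonzero proper $\mathcal{O}$-ideals $\mathfrak{a}$ with $\mathfrak{a}+N\mathcal{O}=\mathcal{O}$, $P_N(\mathcal{O})$ the subgroup generated by the ideals $\nu\mathcal{O}$ with $\nu\in\mathcal{O}\setminus\{0\}$ and $\nu\equiv 1\pmod{N\mathcal{O}}$, and $\mathcal{C}_N(\mathcal{O})=I(\mathcal{O},N)/P_N(\mathcal{O})$. Let $\mathcal{Q}(D,N)$ be the set of primitive positive definite forms $Q=ax^2+bxy+cy^2$ over $\mathbb{Z}$ with $b^2-4ac=D$ and $\gcd(a,N)=1$. For $\gamma\in\mathrm{SL}_2(\mathbb{Z})$ put $Q^\gamma(x,y)=Q(\gamma(x,y)^{T})$; let $\mathcal{C}_N(D)=\mathcal{Q}(D,N)/\!\sim_{\Gamma_1(N)}$ be the set of classes under $Q\sim Q^\gamma$,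 $\gamma\in\Gamma_1(N)$. Let $\omega_Q=(-b+\sqrt{D})/(2a)$ be the zero of $Q(x,1)$ in the upper half-plane, let $[\omega_Q,1]=\mathbb{Z}\omega_Q+\mathbb{Z}$, and put $j(\gamma,\tau)=r\tau+s$ for $\gamma=\begin{bmatrix}p&q\\r&s\end{bmatrix}$. Define a composition law on $\mathcal{C}_N(D)$ as follows. Given $C=[Q]$ and $C'=[Q']$ with $Q=ax^2+bxy+cy^2$ and $Q'$ in $\mathcal{Q}(D,N)$: 1. choose $\gamma\in\mathrm{SL}_2(\mathbb{Z})$ such that $Q''=Q'^{\gamma}=a''x^2+b''xy+c''y^2$ satisfies $\gcd(a,a'',(b+b'')/2)=1$; 2. choose an integer $B$ with $B\equiv b\pmod{2a}$, $B\equiv b''\pmod{2a''}$, $B^2\equiv D\pmod{4aa''}$, and let $Q'''=aa''x^2+Bxy+\frac{B^2-D}{4aa''}y^2$; 3. choose integers $u,v$ with $u\nu_1+v\nu_2=1$, where $\nu_1=\omega_{Q'''}/j(\gamma,\omega_{Q''})$ and $\nu_2=1/j(\gamma,\omega_{Q''})$; 4. choose $\sigma\in\mathrm{SL}_2(\mathbb{Z})$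 whose bottom row is congruent to $(u,v)$ modulo $N$; and set $CC'=[(Q''')^{\sigma^{-1}}]$. Then this law is well defined: each choice is possible whatever the earlier choices were, $(Q''')^{\sigma^{-1}}$ always belongs to $\mathcal{Q}(D,N)$, and its class depends only on $C$ and $C'$. It makes $\mathcal{C}_N(D)$ a finite abelian group. Moreover $[\omega_Q,1]\in I(\mathcal{O},N)$ for every $Q\in\mathcal{Q}(D,N)$, and $$\mathcal{C}_N(D)\to\mathcal{C}_N(\mathcal{O}),\qquad [Q]\mapsto[[\omega_Q,1]]$$ is a well-defined isomorphism of groups. -/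

import Mathlib

open scoped nonZeroDivisors MatrixGroups

namespace FormClassGroup

/-! ### Binary quadratic forms -/

/-- The binary quadratic form `a x² + b x y + c y²` with integer coefficients. -/
@[ext]
structure BinForm where
  a : ℤ
  b : ℤ
  c : ℤ

namespace BinForm

/-- The value `Q(x, y)`. -/
def eval (Q : BinForm) (x y : ℤ) : ℤ := Q.a * x ^ 2 + Q.b * x * y + Q.c * y ^ 2

/-- The discriminant `b² - 4ac`. -/
def disc (Q : BinForm) : ℤ := Q.b ^ 2 - 4 * Q.a * Q.c

/-- The form is primitive: its coefficients have no common factor. -/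
def IsPrimitive (Q : BinForm) : Prop := Int.gcd Q.a (Int.gcd Q.b Q.c) = 1

/-- The form `Q^γ`, that is, `Q(p x + q y, r x + s y)` for `γ = [p, q; r, s]`. -/
def act (Q : BinForm) (γ : SL(2, ℤ)) : BinForm where
  a := Q.a * γ 0 0 ^ 2 + Q.b * γ 0 0 * γ 1 0 + Q.c * γ 1 0 ^ 2
  b := 2 * Q.a * γ 0 0 * γ 0 1 + Q.b * (γ 0 0 * γ 1 1 + γ 0 1 * γ 1 0)
    + 2 * Q.c * γ 1 0 * γ 1 1
  c := Q.a * γ 0 1 ^ 2 + Q.b * γ 0 1 * γ 1 1 + Q.c * γ 1 1 ^ 2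

theorem eval_act (Q : BinForm) (γ : SL(2, ℤ)) (x y : ℤ) :
    (Q.act γ).eval x y = Q.eval (γ 0 0 * x + γ 0 1 * y) (γ 1 0 * x + γ 1 1 * y) := by
  simp only [eval, act]; ring

theorem act_one (Q : BinForm) : Q.act 1 = Q := by
  ext <;> simp [act]

theorem act_mul (Q : BinForm) (γ δ : SL(2, ℤ)) : Q.act (γ * δ) = (Q.act γ).act δ := by
  ext <;>
    simp only [act, Matrix.SpecialLinearGroup.coe_mul, Matrix.mul_apply, Fin.sum_univ_two] <;>
    ring

/-- The zero `ω_Q` of `Q(x, 1)` in the upper half-plane, for `a > 0` and negative discriminant. -/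
noncomputable def omega (Q : BinForm) : ℂ :=
  (-(Q.b : ℂ) + (Real.sqrt (-(Q.disc : ℝ)) : ℂ) * Complex.I) / (2 * (Q.a : ℂ))

theorem omega_im_pos (Q : BinForm) (ha : 0 < Q.a) (hD : Q.disc < 0) : 0 < Q.omega.im := by
  have h1 : (0 : ℝ) < Real.sqrt (-(Q.disc : ℝ)) :=
    Real.sqrt_pos.mpr (by have : (Q.disc : ℝ) < 0 := by exact_mod_cast hD
                          linarith)
  have h2 : (0 : ℝ) < 2 * (Q.a : ℝ) := by
    have : (0 : ℝ) < (Q.a : ℝ) := by exact_mod_cast ha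
    linarith
  have h3 : Q.omega = (-(Q.b : ℂ) + (Real.sqrt (-(Q.disc : ℝ)) : ℂ) * Complex.I) /
      ((2 * (Q.a : ℝ) : ℝ) : ℂ) := by
    simp [omega]
  rw [h3, Complex.div_ofReal_im]
  have h4 : (-(Q.b : ℂ) + (Real.sqrt (-(Q.disc : ℝ)) : ℂ) * Complex.I).im
      = Real.sqrt (-(Q.disc : ℝ)) := by simp
  rw [h4]
  exact div_pos h1 h2

theorem omega_root (Q : BinForm) (ha : 0 < Q.a) (hD : Q.disc < 0) :
    (Q.a : ℂ) * Q.omega ^ 2 + (Q.b : ℂ) * Q.omega + (Q.c : ℂ) = 0 := by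
  have h0 : (Q.a : ℂ) ≠ 0 := by exact_mod_cast ha.ne'
  have h1 : (Real.sqrt (-(Q.disc : ℝ)) : ℂ) ^ 2 = -((Q.b : ℂ) ^ 2 - 4 * Q.a * Q.c) := by
    rw [← Complex.ofReal_pow, Real.sq_sqrt
      (by have : (Q.disc : ℝ) < 0 := by exact_mod_cast hD
          linarith)]
    simp [disc]
  unfold omega
  field_simp
  ring_nf
  rw [h1, Complex.I_sq]
  ring

end BinForm

/-- `Q` belongs to `𝒬(D, N)`: it is primitive of discriminant `D`, with `a > 0` (so that it is
positive definite when `D < 0`) and with `a` prime to `N`. -/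
structure IsFormOf (D : ℤ) (N : ℕ) (Q : BinForm) : Prop where
  primitive : Q.IsPrimitive
  disc_eq : Q.disc = D
  pos : 0 < Q.a
  coprime : Int.gcd Q.a N = 1

/-- The set `𝒬(D, N)` of forms. -/
abbrev Forms (D : ℤ) (N : ℕ) : Type := {Q : BinForm // IsFormOf D N Q}

/-- Equivalence of forms under `Γ₁(N)`. -/
def formSetoid (D : ℤ) (N : ℕ) : Setoid (Forms D N) where
  r Q Q' := ∃ γ ∈ CongruenceSubgroup.Gamma1 N, Q'.1 = Q.1.act γ
  iseqv :=
    { refl := fun Q => ⟨1, one_mem _, (BinForm.act_one Q.1).symm⟩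
      symm := by
        rintro Q Q' ⟨γ, hγ, h⟩
        refine ⟨γ⁻¹, inv_mem hγ, ?_⟩
        rw [h, ← BinForm.act_mul, mul_inv_cancel, BinForm.act_one]
      trans := by
        rintro Q Q' Q'' ⟨γ, hγ, h⟩ ⟨δ, hδ, h'⟩
        exact ⟨γ * δ, mul_mem hγ hδ, by rw [h', h, BinForm.act_mul]⟩ }

/-- The set `𝒞_N(D)` of `Γ₁(N)`-classes of forms in `𝒬(D, N)`. -/
def FormClass (D : ℤ) (N : ℕ) : Type := Quotient (formSetoid D N)

/-- The class `[Q]`. -/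
def FormClass.mk {D : ℤ} {N : ℕ} (Q : Forms D N) : FormClass D N :=
  Quotient.mk (formSetoid D N) Q

/-! ### The composition law -/

/-- `gcd(a, a'', (b + b'')/2) = 1` (for forms of the same discriminant `b + b''` is even). -/
def Concordant (Q Q'' : BinForm) : Prop :=
  Int.gcd Q.a (Int.gcd Q''.a ((Q.b + Q''.b) / 2)) = 1

/-- `B ≡ b mod 2a`, `B ≡ b'' mod 2a''` and `B² ≡ D mod 4aa''`. -/
def IsDirichletMiddle (D : ℤ) (Q Q'' : BinForm) (B : ℤ) : Prop :=
  B ≡ Q.b [ZMOD 2 * Q.a] ∧ B ≡ Q''.b [ZMOD 2 * Q''.a] ∧ B ^ 2 ≡ D [ZMOD 4 * Q.a * Q''.a]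

/-- The Dirichlet composition `a a'' x² + B x y + ((B² - D) / (4 a a'')) y²` of `Q` and `Q''`. -/
def dirichletComp (D : ℤ) (Q Q'' : BinForm) (B : ℤ) : BinForm where
  a := Q.a * Q''.a
  b := B
  c := (B ^ 2 - D) / (4 * Q.a * Q''.a)

/-- The factor `j(γ, τ) = r τ + s` for `γ = [p, q; r, s]`. -/
noncomputable def autFactor (γ : SL(2, ℤ)) (τ : ℂ) : ℂ := (γ 1 0 : ℂ) * τ + (γ 1 1 : ℂ)

/-- `u ν₁ + v ν₂ = 1`, where `ν₁ = ω_{Q'''} / j(γ, ω_{Q''})` and `ν₂ = 1 / j(γ, ω_{Q''})`. -/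
def IsUnitRelation (γ : SL(2, ℤ)) (Q'' Q''' : BinForm) (u v : ℤ) : Prop :=
  (u : ℂ) * (Q'''.omega / autFactor γ Q''.omega) + (v : ℂ) * (1 / autFactor γ Q''.omega) = 1

/-- The bottom row of `σ` is congruent to `(u, v)` modulo `N`. -/
def BottomRow (N : ℕ) (σ : SL(2, ℤ)) (u v : ℤ) : Prop :=
  σ 1 0 ≡ u [ZMOD N] ∧ σ 1 1 ≡ v [ZMOD N]

/-- `op` is the composition law on `𝒞_N(D)`: for all `Q`, `Q'` in `𝒬(D, N)` the choices
of `γ`, `B`, `(u, v)` and `σ` can be made one after the other, each whatever the earlier ones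
were, and whatever they are, `(Q''')^{σ⁻¹}` belongs to `𝒬(D, N)` and its class is `[Q] [Q']`.
Here `Q'' = Q'^γ` and `Q'''` is the Dirichlet composition of `Q` and `Q''` with middle
coefficient `B`. -/
def IsCompositionLaw (D : ℤ) (N : ℕ)
    (op : FormClass D N → FormClass D N → FormClass D N) : Prop :=
  ∀ Q Q' : Forms D N,
    (∃ γ : SL(2, ℤ), Concordant Q.1 (Q'.1.act γ)) ∧
    ∀ γ : SL(2, ℤ), Concordant Q.1 (Q'.1.act γ) →
      (∃ B : ℤ, IsDirichletMiddle D Q.1 (Q'.1.act γ) B) ∧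
      ∀ B : ℤ, IsDirichletMiddle D Q.1 (Q'.1.act γ) B →
        (∃ u v : ℤ,
          IsUnitRelation γ (Q'.1.act γ) (dirichletComp D Q.1 (Q'.1.act γ) B) u v) ∧
        ∀ u v : ℤ,
          IsUnitRelation γ (Q'.1.act γ) (dirichletComp D Q.1 (Q'.1.act γ) B) u v →
          (∃ σ : SL(2, ℤ), BottomRow N σ u v) ∧
          ∀ σ : SL(2, ℤ), BottomRow N σ u v →
            ∃ h : IsFormOf D N ((dirichletComp D Q.1 (Q'.1.act γ) B).act σ⁻¹),
              FormClass.mk ⟨(dirichletComp D Q.1 (Q'.1.act γ) B).act σ⁻¹, h⟩ =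
                op (FormClass.mk Q) (FormClass.mk Q')

/-! ### Orders and their ray class groups -/

section Orders

variable {K : Type*} [Field K]

/-- `O` is an order in `K`: a subring that is finitely generated as an abelian group and
contains a `ℚ`-basis of `K`. -/
structure IsOrder [CharZero K] (O : Subring K) : Prop where
  finite : Module.Finite ℤ O
  span_eq_top : Submodule.span ℚ (O : Set K) = ⊤

open Classical in
/-- The discriminant of `O`: the discriminant of the trace form on a `ℤ`-basis of `O`
(and `0` if `O` is not finitely generated, which does not happen for orders). -/
noncomputable def orderDiscr [CharZero K] (O : Subring K) : ℤ :=
  if _h : Module.Finite ℤ O then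
    Algebra.discr ℤ (Module.Free.chooseBasis ℤ O)
  else 0

/-- The ideal `𝔞` is proper: `{β ∈ K | β 𝔞 ⊆ 𝔞} = O`. -/
def IsProperIdeal (O : Subring K) (𝔞 : Ideal O) : Prop :=
  {β : K | ∀ x ∈ 𝔞, ∃ y ∈ 𝔞, β * (x : K) = (y : K)} = (O : Set K)

/-- The group `I(O)` of proper fractional `O`-ideals. These are the invertible fractional ideals,
since for a nonzero fractional ideal of an order in a quadratic field properness and
invertibility are the same. -/
abbrev IdealGroup (O : Subring K) : Type _ := (FractionalIdeal O⁰ K)ˣ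

/-- The subgroup `I(O, N)` of `I(O)` generated by the nonzero proper ideals of `O`
that are prime to `N`. -/
def idealsPrimeTo (O : Subring K) (N : ℕ) : Subgroup (IdealGroup O) :=
  Subgroup.closure {I | ∃ 𝔞 : Ideal O, 𝔞 ≠ ⊥ ∧ IsProperIdeal O 𝔞 ∧
    𝔞 ⊔ Ideal.span {(N : O)} = ⊤ ∧ (I : FractionalIdeal O⁰ K) = (𝔞 : FractionalIdeal O⁰ K)}

/-- The subgroup `P_N(O)` of `I(O)` generated by the `ν O` with `ν ∈ O` nonzero and
`ν ≡ 1 mod N O`. -/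
def principalRay (O : Subring K) (N : ℕ) : Subgroup (IdealGroup O) :=
  Subgroup.closure {I | ∃ ν : O, ν ≠ 0 ∧ ν - 1 ∈ Ideal.span {(N : O)} ∧
    (I : FractionalIdeal O⁰ K) = ((Ideal.span {ν} : Ideal O) : FractionalIdeal O⁰ K)}

/-- The ray class group `𝒞_N(O) = I(O, N) / P_N(O)`. -/
abbrev RayClassGroup (O : Subring K) (N : ℕ) : Type _ :=
  idealsPrimeTo O N ⧸ (principalRay O N).subgroupOf (idealsPrimeTo O N)

/-- The fractional ideal `I` is the lattice `[ω_Q, 1] = ℤ ω_Q + ℤ`, where `K` is regarded as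
a subfield of `ℂ` through `ι`. -/
def IsFormLattice (ι : K →+* ℂ) (O : Subring K) (Q : BinForm) (I : FractionalIdeal O⁰ K) :
    Prop :=
  ∃ ω : K, ι ω = Q.omega ∧ ∀ z : K, z ∈ I ↔ ∃ m n : ℤ, z = (m : K) * ω + (n : K)

end Orders

end FormClassGroup

namespace FormClassGroup

/-! ### Integers and matrices -/

/-! Everything rests on the map `Q ↦ [ω_Q, 1]`. It is a bijection from form classes to ray classes;
the group structure is transported along it, and the composition recipe is checked to compute the
transported product. Independence of choices, associativity and inverses then need no argument about
forms.

Passing from `Q` to `Q^γ` multiplies the lattice by `j(γ, ω_{Q^γ})` (`formIdeal_act`). For `γ ∈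
Γ₁(N)` this number is 1 modulo `N` up to a denominator prime to `N`, so the ray class does not
change. Dirichlet composition of concordant forms multiplies lattices (`formIdeal_mul`). Replacing
`Q'` by `Q'' = Q'^γ` introduces the factor `j(γ, ω'') = u ω''' + v`, and acting by `σ⁻¹`, with `(u,
v)` the bottom row of `σ` modulo `N`, removes it up to the ray (`rayClass_comp`). Such a `σ` exists,
and the result has leading coefficient prime to `N`, because `Q'''(v, -u) = a a'`
(`IsDirichletMiddle.eval_eq`).

Injectivity (`rel_of_rayClass_eq`): lattices in one ray class differ by a scalar, so their bases
differ by an integral matrix. Orientation makes its determinant 1 and the ray condition puts it in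
`Γ₁(N)`. Surjectivity: an integral ideal prime to `N` has a `ℤ`-basis containing some `ν ≡ 1` modulo
`N`, hence is `ν [w, 1]`, where `w` is the zero of a form of discriminant `D` (`exists_rayClass_eq`,
`isFormOf_of_multiplier`). Such ideals generate, and the image is closed under products and finite
by reduction theory (`finite_formClass`), hence a subgroup. -/

theorem det_eq_one (γ : SL(2, ℤ)) : γ 0 0 * γ 1 1 - γ 0 1 * γ 1 0 = 1 := by
  have h := γ.det_coe
  rwa [Matrix.det_fin_two] at h

theorem isCoprime_of_forall_prime {x y : ℤ}
    (h : ∀ p : ℤ, Prime p → p ∣ x → ¬ p ∣ y) (h0 : x ≠ 0 ∨ y ≠ 0) : IsCoprime x y := by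
  refine isCoprime_of_prime_dvd (by tauto) ?_
  intro p hp hx hy
  exact h p hp hx hy

/-- For every finite set of primes cut out by a predicate among the prime divisors of `M`,
there is an integer whose prime divisors are exactly these. -/
theorem exists_prime_dvd_iff (M : ℤ) (hM : M ≠ 0) (P : ℤ → Prop)
    (hP : ∀ p, P (-p) ↔ P p) :
    ∃ x : ℤ, x ≠ 0 ∧ ∀ p : ℤ, Prime p → (p ∣ x ↔ p ∣ M ∧ P p) := by
  classical
  refine ⟨∏ q ∈ M.natAbs.primeFactors.filter (fun q : ℕ => P (q : ℤ)), (q : ℤ), ?_, ?_⟩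
  · rw [Finset.prod_ne_zero_iff]
    intro q hq
    simp only [Finset.mem_filter, Nat.mem_primeFactors] at hq
    exact_mod_cast hq.1.1.ne_zero
  · intro p hp
    have hPabs : P (p.natAbs : ℤ) ↔ P p := by
      rcases Int.natAbs_eq p with h | h
      · rw [← h]
      · rw [← hP p, h]; simp
    rw [hp.dvd_finsetProd_iff]
    constructor
    · rintro ⟨q, hq, hpq⟩
      simp only [Finset.mem_filter, Nat.mem_primeFactors] at hq
      have h1 : p.natAbs = q :=
        (Nat.prime_dvd_prime_iff_eq (Int.prime_iff_natAbs_prime.mp hp) hq.1.1).mp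
          (Int.natAbs_dvd_natAbs.mpr hpq)
      subst h1
      exact ⟨Int.natAbs_dvd_natAbs.mp hq.1.2.1, hPabs.mp hq.2⟩
    · rintro ⟨h1, h2⟩
      refine ⟨p.natAbs, ?_, by simp⟩
      simp only [Finset.mem_filter, Nat.mem_primeFactors]
      exact ⟨⟨Int.prime_iff_natAbs_prime.mp hp, Int.natAbs_dvd_natAbs.mpr h1, by simpa using hM⟩,
        hPabs.mpr h2⟩

/-- An arithmetic progression `v + k n` meets the residues prime to `u`. -/
theorem exists_isCoprime_add_mul {u v n : ℤ} (hu : u ≠ 0)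
    (h : ∀ p : ℤ, Prime p → p ∣ u → p ∣ v → ¬ p ∣ n) : ∃ k : ℤ, IsCoprime u (v + k * n) := by
  -- The primes of `k` are those of `u` that do not divide `v`, so each prime of `u` divides exactly
  -- one of `v` and `k * n`.
  obtain ⟨k, -, hk⟩ := exists_prime_dvd_iff u hu (fun p => ¬ p ∣ v) (by simp)
  refine ⟨k, isCoprime_of_forall_prime ?_ (Or.inl hu)⟩
  intro p hp hpu hpv
  by_cases hv : p ∣ v
  · rcases hp.dvd_or_dvd ((Int.dvd_add_right hv).mp hpv) with h1 | h1
    · exact ((hk p hp).mp h1).2 hv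
    · exact h p hp hpu hv h1
  · have : p ∣ k := (hk p hp).mpr ⟨hpu, hv⟩
    exact hv ((Int.dvd_add_left (this.mul_right n)).mp hpv)

/-- `SL₂(ℤ)` attains all bottom rows modulo `N` that are unimodular modulo `N`. -/
theorem exists_bottomRow {N : ℕ} (hN : 0 < N) {u v : ℤ}
    (h : ∀ p : ℤ, Prime p → p ∣ u → p ∣ v → ¬ p ∣ (N : ℤ)) :
    ∃ σ : SL(2, ℤ), BottomRow N σ u v := by
  have hN0 : (N : ℤ) ≠ 0 := by exact_mod_cast hN.ne'
  obtain ⟨u', hu', hu0⟩ : ∃ u' : ℤ, (∃ t, u' = u + N * t) ∧ u' ≠ 0 := by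
    -- The progression lemma needs a nonzero modulus, so `u = 0` is replaced by `N`.
    by_cases hu : u = 0
    · exact ⟨N, ⟨1, by simp [hu]⟩, hN0⟩
    · exact ⟨u, ⟨0, by simp⟩, hu⟩
  obtain ⟨t, rfl⟩ := hu'
  obtain ⟨k, hk⟩ := exists_isCoprime_add_mul (v := v) (n := N) hu0 (by
    intro p hp h1 h2 h3
    exact h p hp ((Int.dvd_add_left (h3.mul_right t)).mp h1) h2 h3)
  obtain ⟨σ, hσ⟩ := hk.exists_SL2_row 1
  refine ⟨σ, ?_, ?_⟩
  · rw [hσ.1]; simp [Int.ModEq]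
  · rw [hσ.2]; simp [Int.ModEq]

namespace BinForm

/-! ### The action on forms -/

theorem isPrimitive_iff (Q : BinForm) :
    Q.IsPrimitive ↔ ∀ d : ℤ, d ∣ Q.a → d ∣ Q.b → d ∣ Q.c → IsUnit d := by
  unfold IsPrimitive
  constructor
  · intro h d h1 h2 h3
    have : d ∣ (Int.gcd Q.a (Int.gcd Q.b Q.c) : ℤ) := Int.dvd_coe_gcd h1 (Int.dvd_coe_gcd h2 h3)
    rw [h] at this
    exact isUnit_of_dvd_one (by exact_mod_cast this)
  · intro h
    have h2 : (Int.gcd Q.a (Int.gcd Q.b Q.c) : ℤ) ∣ (Int.gcd Q.b Q.c : ℤ) :=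
      Int.gcd_dvd_right ..
    have := h (Int.gcd Q.a (Int.gcd Q.b Q.c)) (Int.gcd_dvd_left ..)
      (h2.trans (Int.gcd_dvd_left ..)) (h2.trans (Int.gcd_dvd_right ..))
    simpa [Int.isUnit_iff] using this

theorem disc_act (Q : BinForm) (γ : SL(2, ℤ)) : (Q.act γ).disc = Q.disc := by
  have h := det_eq_one γ
  simp only [disc, act]
  linear_combination (Q.b ^ 2 - 4 * Q.a * Q.c) *
    ((γ 0 0 * γ 1 1 - γ 0 1 * γ 1 0) + 1) * h

theorem dvd_act {Q : BinForm} {d : ℤ} (h : d ∣ Q.a ∧ d ∣ Q.b ∧ d ∣ Q.c) (γ : SL(2, ℤ)) :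
    d ∣ (Q.act γ).a ∧ d ∣ (Q.act γ).b ∧ d ∣ (Q.act γ).c := by
  obtain ⟨⟨x, hx⟩, ⟨y, hy⟩, ⟨z, hz⟩⟩ := h
  simp only [act, hx, hy, hz]
  exact ⟨⟨x * γ 0 0 ^ 2 + y * γ 0 0 * γ 1 0 + z * γ 1 0 ^ 2, by ring⟩,
    ⟨2 * x * γ 0 0 * γ 0 1 + y * (γ 0 0 * γ 1 1 + γ 0 1 * γ 1 0)
      + 2 * z * γ 1 0 * γ 1 1, by ring⟩,
    ⟨x * γ 0 1 ^ 2 + y * γ 0 1 * γ 1 1 + z * γ 1 1 ^ 2, by ring⟩⟩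

theorem act_act_inv (Q : BinForm) (γ : SL(2, ℤ)) : (Q.act γ).act γ⁻¹ = Q := by
  rw [← act_mul, mul_inv_cancel, act_one]

theorem act_inv_act (Q : BinForm) (γ : SL(2, ℤ)) : (Q.act γ⁻¹).act γ = Q := by
  rw [← act_mul, inv_mul_cancel, act_one]

theorem IsPrimitive.act {Q : BinForm} (h : Q.IsPrimitive) (γ : SL(2, ℤ)) :
    (Q.act γ).IsPrimitive := by
  rw [isPrimitive_iff] at h ⊢
  intro d h1 h2 h3
  have := dvd_act ⟨h1, h2, h3⟩ γ⁻¹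
  rw [act_act_inv] at this
  exact h d this.1 this.2.1 this.2.2

theorem eval_pos {Q : BinForm} (ha : 0 < Q.a) (hD : Q.disc < 0) {x y : ℤ}
    (h : x ≠ 0 ∨ y ≠ 0) : 0 < Q.eval x y := by
  have key : 4 * Q.a * Q.eval x y = (2 * Q.a * x + Q.b * y) ^ 2 - Q.disc * y ^ 2 := by
    simp only [eval, disc]; ring
  have hpos : 0 < 4 * Q.a * Q.eval x y := by
    rw [key]
    by_cases hy : y = 0
    · subst hy
      have hx : x ≠ 0 := by tauto
      have : 2 * Q.a * x ≠ 0 := by simp [hx, ha.ne']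
      have : 0 < (2 * Q.a * x) ^ 2 := by positivity
      simpa using this
    · have : 0 < y ^ 2 := by positivity
      nlinarith [sq_nonneg (2 * Q.a * x + Q.b * y)]
  exact pos_of_mul_pos_right hpos (by positivity)

theorem act_a (Q : BinForm) (γ : SL(2, ℤ)) : (Q.act γ).a = Q.eval (γ 0 0) (γ 1 0) := rfl

theorem act_a_pos {Q : BinForm} (ha : 0 < Q.a) (hD : Q.disc < 0) (γ : SL(2, ℤ)) :
    0 < (Q.act γ).a := by
  rw [act_a]
  refine eval_pos ha hD ?_
  by_contra! h
  have := det_eq_one γ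
  simp [h.1, h.2] at this

/-- Sort the primes `p` of `M`. If `p ∤ a`, let `p` divide `y` only; if `p ∣ a` but `p ∤ c`, let it
divide `x` only; if `p` divides both, let it divide neither. Modulo `p` the value is then `a x²`, `c
y²` or `b x y`, and in the last case primitivity gives `p ∤ b`. -/
theorem IsPrimitive.exists_isCoprime_eval {Q : BinForm} (hQ : Q.IsPrimitive) {M : ℤ}
    (hM : M ≠ 0) : ∃ x y : ℤ, IsCoprime x y ∧ IsCoprime M (Q.eval x y) := by
  rw [isPrimitive_iff] at hQ
  obtain ⟨x, hx0, hx⟩ := exists_prime_dvd_iff M hM (fun p => p ∣ Q.a ∧ ¬ p ∣ Q.c) (by simp)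
  obtain ⟨y, -, hy⟩ := exists_prime_dvd_iff M hM (fun p => ¬ p ∣ Q.a) (by simp)
  refine ⟨x, y, isCoprime_of_forall_prime ?_ (Or.inl hx0),
    isCoprime_of_forall_prime ?_ (Or.inl hM)⟩
  · intro p hp h1 h2
    exact ((hy p hp).mp h2).2 ((hx p hp).mp h1).2.1
  · intro p hp hpM h
    unfold eval at h
    by_cases ha : p ∣ Q.a
    · have hny : ¬ p ∣ y := fun h' => ((hy p hp).mp h').2 ha
      by_cases hc : p ∣ Q.c
      · have hnx : ¬ p ∣ x := fun h' => ((hx p hp).mp h').2.2 hc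
        rw [Int.dvd_add_left (hc.mul_right _), Int.dvd_add_right (ha.mul_right _)] at h
        rcases hp.dvd_or_dvd h with h | h
        · rcases hp.dvd_or_dvd h with h | h
          · exact hp.not_isUnit (hQ p ha h hc)
          · exact hnx h
        · exact hny h
      · have hpx : p ∣ x := (hx p hp).mpr ⟨hpM, ha, hc⟩
        rw [Int.dvd_add_right ((ha.mul_right _).add ((hpx.mul_left _).mul_right _))] at h
        rcases hp.dvd_or_dvd h with h | h
        · exact hc h
        · exact hny (hp.dvd_of_dvd_pow h)
    · have hpy : p ∣ y := (hy p hp).mpr ⟨hpM, ha⟩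
      have hnx : ¬ p ∣ x := fun h' => ha ((hx p hp).mp h').2.1
      rw [Int.dvd_add_left ((hpy.pow two_ne_zero).mul_left _),
        Int.dvd_add_left (hpy.mul_left _)] at h
      rcases hp.dvd_or_dvd h with h | h
      · exact ha h
      · exact hnx (hp.dvd_of_dvd_pow h)

theorem exists_concordant {Q Q' : BinForm} (hQ : Q.a ≠ 0) (hQ' : Q'.IsPrimitive) :
    ∃ γ : SL(2, ℤ), Concordant Q (Q'.act γ) := by
  obtain ⟨x, y, hxy, h⟩ := hQ'.exists_isCoprime_eval hQ
  obtain ⟨γ, hγ⟩ := hxy.exists_SL2_col 0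
  refine ⟨γ, ?_⟩
  have h1 : (Q'.act γ).a = Q'.eval x y := by rw [act_a, hγ.1, hγ.2]
  unfold Concordant
  rw [h1]
  have h2 := Int.isCoprime_iff_gcd_eq_one.mp h
  apply Nat.eq_one_of_dvd_one
  rw [← h2]
  apply Int.dvd_gcd
  · exact Int.gcd_dvd_left ..
  · exact (Int.gcd_dvd_right ..).trans (Int.gcd_dvd_left ..)

/-! ### Dirichlet composition -/

theorem two_dvd_sub_of_disc_eq {Q Q' : BinForm} (h : Q.disc = Q'.disc) : (2 : ℤ) ∣ Q'.b - Q.b := by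
  unfold disc at h
  have : Even (Q'.b ^ 2 - Q.b ^ 2) :=
    ⟨2 * (Q'.a * Q'.c - Q.a * Q.c), by linear_combination -h⟩
  rw [Int.even_sub, Int.even_pow' two_ne_zero, Int.even_pow' two_ne_zero, ← Int.even_sub] at this
  exact this.two_dvd

theorem exists_bezout_of_gcd_eq_one {x y z : ℤ} (h : Int.gcd x (Int.gcd y z) = 1) :
    ∃ u v w : ℤ, u * x + v * y + w * z = 1 := by
  obtain ⟨s, t, h1⟩ := Int.isCoprime_iff_gcd_eq_one.mpr h
  refine ⟨s, t * Int.gcdA y z, t * Int.gcdB y z, ?_⟩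
  rw [Int.gcd_eq_gcd_ab y z] at h1
  linear_combination h1

/-- Given the Bézout relation `u a + v a'' + w (b + b'')/2 = 1`, the classical solution is `B = u a
b'' + v a'' b + w (b b'' + D)/2`. With `b'' = b + 2t` it simplifies to `b + 2a (u t - w c)`, the
witness used here. -/
theorem exists_isDirichletMiddle {D : ℤ} {Q Q'' : BinForm} (hQ : Q.disc = D)
    (hQ'' : Q''.disc = D) (h : Concordant Q Q'') : ∃ B : ℤ, IsDirichletMiddle D Q Q'' B := by
  obtain ⟨t, ht⟩ := two_dvd_sub_of_disc_eq (hQ.trans hQ''.symm)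
  have hs : (Q.b + Q''.b) / 2 = Q.b + t := by omega
  unfold Concordant at h
  rw [hs] at h
  obtain ⟨u, v, w, huvw⟩ := exists_bezout_of_gcd_eq_one h
  unfold disc at hQ hQ''
  have hb : Q''.b = Q.b + 2 * t := by omega
  rw [hb] at hQ''
  have hE : Q.a * Q.c + t * (Q.b + t) = Q''.a * Q''.c := by linarith
  have hB : Q.b + 2 * Q.a * (u * t - w * Q.c)
      = Q.b + 2 * t + 2 * Q''.a * (-v * t - w * Q''.c) := by
    linear_combination 2 * t * huvw - 2 * w * hE
  have hs' : 2 * (Q.b + t) * (Q.b + 2 * Q.a * (u * t - w * Q.c))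
      = Q.b * (Q.b + 2 * t) + D + 4 * Q.a * Q''.a * (u * Q''.c + v * Q.c) := by
    linear_combination (-4 * Q.a * Q.c) * huvw + 4 * Q.a * u * hE + hQ
  refine ⟨Q.b + 2 * Q.a * (u * t - w * Q.c), ?_, ?_, ?_⟩
  · exact Int.modEq_iff_dvd.mpr ⟨-(u * t - w * Q.c), by ring⟩
  · exact Int.modEq_iff_dvd.mpr ⟨-(-v * t - w * Q''.c), by rw [hB, hb]; ring⟩
  · refine (Int.modEq_iff_dvd.mpr ⟨(u * t - w * Q.c) * (-v * t - w * Q''.c) + u * Q''.c + v * Q.c,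
      ?_⟩).symm
    linear_combination hs' + 2 * Q.a * (u * t - w * Q.c) * hB

/-- The data hidden in the congruences for the middle coefficient. -/
theorem _root_.FormClassGroup.IsDirichletMiddle.exists_eq {D : ℤ} {Q Q'' : BinForm} {B : ℤ}
    (h : IsDirichletMiddle D Q Q'' B) (hQ : Q.disc = D) (hQ'' : Q''.disc = D)
    (ha : Q.a ≠ 0) (ha'' : Q''.a ≠ 0) :
    ∃ X Y : ℤ, B = Q.b + 2 * Q.a * X ∧ B = Q''.b + 2 * Q''.a * Y ∧
      Q''.a * (dirichletComp D Q Q'' B).c = Q.c + Q.b * X + Q.a * X ^ 2 ∧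
      Q.a * (dirichletComp D Q Q'' B).c = Q''.c + Q''.b * Y + Q''.a * Y ^ 2 ∧
      (dirichletComp D Q Q'' B).disc = D := by
  obtain ⟨h1, h2, h3⟩ := h
  obtain ⟨X, hX⟩ := Int.modEq_iff_dvd.mp h1.symm
  obtain ⟨Y, hY⟩ := Int.modEq_iff_dvd.mp h2.symm
  obtain ⟨Z, hZ⟩ := Int.modEq_iff_dvd.mp h3.symm
  have hc : (dirichletComp D Q Q'' B).c = Z := by
    simp only [dirichletComp]
    rw [hZ, Int.mul_ediv_cancel_left _ (by simp [ha, ha''])]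
  rw [hc]
  unfold disc at hQ hQ'' ⊢
  have hX' : B = Q.b + 2 * Q.a * X := by linarith
  have hY' : B = Q''.b + 2 * Q''.a * Y := by linarith
  refine ⟨X, Y, hX', hY', ?_, ?_, ?_⟩
  · apply mul_left_cancel₀ (mul_ne_zero four_ne_zero ha)
    linear_combination -hZ + hQ + (B + Q.b + 2 * Q.a * X) * hX'
  · apply mul_left_cancel₀ (mul_ne_zero four_ne_zero ha'')
    linear_combination -hZ + hQ'' + (B + Q''.b + 2 * Q''.a * Y) * hY'
  · rw [hc]
    simp only [dirichletComp]
    linear_combination hZ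

theorem isPrimitive_of_forall_prime {Q : BinForm} (ha : Q.a ≠ 0)
    (h : ∀ p : ℤ, Prime p → p ∣ Q.a → p ∣ Q.b → ¬ p ∣ Q.c) : Q.IsPrimitive := by
  rw [isPrimitive_iff]
  intro d h1 h2 h3
  by_contra hd
  obtain ⟨p, hp, hpd⟩ := WfDvdMonoid.exists_irreducible_factor hd
    (fun h0 => ha (zero_dvd_iff.mp (h0 ▸ h1)))
  exact h p hp.prime (hpd.trans h1) (hpd.trans h2) (hpd.trans h3)

theorem IsPrimitive.not_dvd {Q : BinForm} (hQ : Q.IsPrimitive) {p : ℤ} (hp : Prime p)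
    (h1 : p ∣ Q.a) (h2 : p ∣ Q.b) : ¬ p ∣ Q.c :=
  fun h3 => hp.not_isUnit ((isPrimitive_iff Q).mp hQ p h1 h2 h3)

/-- A prime dividing all three coefficients divides `a` or `a''`; since the composite is a translate
of `Q` or `Q''` with the outer coefficients rescaled, that prime would divide all coefficients of
`Q` or of `Q''`. -/
theorem isPrimitive_dirichletComp {D : ℤ} {Q Q'' : BinForm} {B : ℤ}
    (h : IsDirichletMiddle D Q Q'' B) (hQ : Q.disc = D) (hQ'' : Q''.disc = D)
    (ha : Q.a ≠ 0) (ha'' : Q''.a ≠ 0) (hp : Q.IsPrimitive) (hp'' : Q''.IsPrimitive) :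
    (dirichletComp D Q Q'' B).IsPrimitive := by
  obtain ⟨X, Y, hX, hY, hcX, hcY, -⟩ := h.exists_eq hQ hQ'' ha ha''
  apply isPrimitive_of_forall_prime (by simp [dirichletComp, ha, ha''])
  intro p hpp h1 h2 h3
  rcases hpp.dvd_or_dvd (show p ∣ Q.a * Q''.a from h1) with h4 | h4
  · have h5 : p ∣ Q.b := by
      rw [show Q.b = B - Q.a * (2 * X) by linear_combination -hX]
      exact dvd_sub h2 (h4.mul_right _)
    refine hp.not_dvd hpp h4 h5 ?_
    rw [show Q.c = Q''.a * (dirichletComp D Q Q'' B).c - Q.b * X - Q.a * X ^ 2 by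
      linear_combination -hcX]
    exact dvd_sub (dvd_sub (h3.mul_left _) (h5.mul_right _)) (h4.mul_right _)
  · have h5 : p ∣ Q''.b := by
      rw [show Q''.b = B - Q''.a * (2 * Y) by linear_combination -hY]
      exact dvd_sub h2 (h4.mul_right _)
    refine hp''.not_dvd hpp h4 h5 ?_
    rw [show Q''.c = Q.a * (dirichletComp D Q Q'' B).c - Q''.b * Y - Q''.a * Y ^ 2 by
      linear_combination -hcY]
    exact dvd_sub (dvd_sub (h3.mul_left _) (h5.mul_right _)) (h4.mul_right _)

/-! ### Reduction and finiteness -/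

theorem exists_act_abs_le (Q : BinForm) (ha : 0 < Q.a) :
    ∃ γ : SL(2, ℤ), (Q.act γ).a = Q.a ∧ |(Q.act γ).b| ≤ Q.a := by
  -- This translation moves `b` to its residue modulo `2a` in `[-a, a)`.
  refine ⟨ModularGroup.T ^ (-((Q.b + Q.a) / (2 * Q.a))), ?_, ?_⟩
  · simp [act, ModularGroup.coe_T_zpow]
  · have hb : (Q.act (ModularGroup.T ^ (-((Q.b + Q.a) / (2 * Q.a))))).b
        = (Q.b + Q.a) % (2 * Q.a) - Q.a := by
      have := Int.emod_add_mul_ediv (Q.b + Q.a) (2 * Q.a)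
      simp only [act, ModularGroup.coe_T_zpow]
      simp
      linarith
    rw [hb, abs_le]
    have h1 := Int.emod_nonneg (Q.b + Q.a) (show 2 * Q.a ≠ 0 by omega)
    have h2 := Int.emod_lt_of_pos (Q.b + Q.a) (show 0 < 2 * Q.a by omega)
    constructor <;> linarith

/-- Gauss reduction. After translating, if still `c < a`, then `S` makes `c` the leading
coefficient, which is smaller and still positive; `n` bounds the descent. -/
theorem exists_act_reduced (n : ℕ) : ∀ Q : BinForm, Q.a.toNat ≤ n → 0 < Q.a → Q.disc < 0 →
    ∃ γ : SL(2, ℤ), |(Q.act γ).b| ≤ (Q.act γ).a ∧ (Q.act γ).a ≤ (Q.act γ).c := by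
  induction n with
  | zero => intro Q h1 h2; omega
  | succ n ih =>
    intro Q hn ha hD
    obtain ⟨γ, h1, h2⟩ := exists_act_abs_le Q ha
    by_cases hc : (Q.act γ).a ≤ (Q.act γ).c
    · exact ⟨γ, h1 ▸ h2, hc⟩
    · have hS : ((Q.act γ).act ModularGroup.S).a = (Q.act γ).c := by
        simp [act, ModularGroup.S]
      have hpos := act_a_pos ha hD (γ * ModularGroup.S)
      rw [act_mul] at hpos
      obtain ⟨δ, hδ⟩ := ih ((Q.act γ).act ModularGroup.S) (by omega) hpos
        (by rwa [disc_act, disc_act])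
      refine ⟨γ * ModularGroup.S * δ, ?_⟩
      rwa [act_mul, act_mul]

/-- The inequalities `|b| ≤ a ≤ c` give `-D ≥ 3a²`, which bounds `a` and `b`, and then `4ac = b² -
D` bounds `c`. The box chosen is generous. -/
theorem finite_reduced (D : ℤ) :
    {Q : BinForm | Q.disc = D ∧ 0 < Q.a ∧ |Q.b| ≤ Q.a ∧ Q.a ≤ Q.c}.Finite := by
  let f : ℤ × ℤ × ℤ → BinForm := fun t => ⟨t.1, t.2.1, t.2.2⟩
  refine (((Set.finite_Icc 0 (-D)).prod ((Set.finite_Icc D (-D)).prod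
    (Set.finite_Icc 0 (D ^ 2 - D)))).image f).subset ?_
  rintro ⟨a, b, c⟩ ⟨h1, h2, h3, h4⟩
  simp only [disc] at h1 h2 h3 h4
  have hb : b ^ 2 ≤ a ^ 2 := sq_le_sq' (abs_le.mp h3).1 (abs_le.mp h3).2
  have ha : a ≤ -D := by nlinarith
  refine ⟨(a, b, c), ?_, rfl⟩
  obtain ⟨h5, h6⟩ := abs_le.mp h3
  have hb2 : b ^ 2 ≤ D ^ 2 := by nlinarith
  have hc : c ≤ D ^ 2 - D := by nlinarith
  have hl : D ≤ b := by omega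
  have hu : b ≤ -D := by omega
  exact ⟨⟨h2.le, ha⟩, ⟨hl, hu⟩, ⟨h2.le.trans h4, hc⟩⟩

end BinForm

/-- A class is determined by a reduced form `Q^γ` together with `γ` modulo `N`: if two
representatives share both, they differ by an element of `Γ(N)`, which lies in `Γ₁(N)`. -/
theorem finite_formClass {D : ℤ} (hD : D < 0) {N : ℕ} (hN : 0 < N) : Finite (FormClass D N) := by
  have : NeZero N := ⟨hN.ne'⟩
  have hred : ∀ C : FormClass D N, ∃ (Q : Forms D N) (γ : SL(2, ℤ)), FormClass.mk Q = C ∧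
      Q.1.act γ ∈ {Q : BinForm | Q.disc = D ∧ 0 < Q.a ∧ |Q.b| ≤ Q.a ∧ Q.a ≤ Q.c} := by
    intro C
    obtain ⟨Q, rfl⟩ := Quotient.exists_rep C
    have hQ : Q.1.disc < 0 := by rw [Q.2.disc_eq]; exact hD
    obtain ⟨γ, h⟩ := BinForm.exists_act_reduced _ Q.1 le_rfl Q.2.pos hQ
    exact ⟨Q, γ, rfl, by rw [BinForm.disc_act, Q.2.disc_eq], BinForm.act_a_pos Q.2.pos hQ γ, h⟩
  choose R γ hR hγ using hred
  have := (BinForm.finite_reduced D).to_subtype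
  refine Finite.of_injective (β := {Q : BinForm | Q.disc = D ∧ 0 < Q.a ∧ |Q.b| ≤ Q.a ∧ Q.a ≤ Q.c} ×
    SL(2, ZMod N)) (fun C => (⟨(R C).1.act (γ C), hγ C⟩,
      Matrix.SpecialLinearGroup.map (Int.castRingHom (ZMod N)) (γ C))) ?_
  intro C C' h
  simp only [Prod.mk.injEq, Subtype.mk.injEq] at h
  obtain ⟨h1, h2⟩ := h
  rw [← hR C, ← hR C']
  refine Quotient.sound ⟨γ C * (γ C')⁻¹, ?_, ?_⟩
  · have : γ C * (γ C')⁻¹ ∈ CongruenceSubgroup.Gamma N := by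
      rw [CongruenceSubgroup.Gamma, MonoidHom.mem_ker, map_mul, map_inv, h2, mul_inv_cancel]
    rw [CongruenceSubgroup.Gamma_mem] at this
    rw [CongruenceSubgroup.Gamma1_mem]
    exact ⟨this.1, this.2.2.2, this.2.2.1⟩
  · rw [BinForm.act_mul, h1, BinForm.act_act_inv]

end FormClassGroup

/-! ### Zeros of forms inside the quadratic field -/

namespace FormClassGroup

variable {K : Type*} [Field K]

/-- The zero `(-b + δ) / (2a)` of `Q(x, 1)`, where `δ` is a square root of the discriminant. -/
def BinForm.root (δ : K) (Q : BinForm) : K := (-(Q.b : K) + δ) / (2 * (Q.a : K))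

/-- The ring `O` is the order `ℤ + ℤ (D + δ) / 2`, where `δ` is the square root of `D < 0` in
the upper half-plane. -/
structure IsQuadOrder (ι : K →+* ℂ) (O : Subring K) (D : ℤ) (δ : K) : Prop where
  neg : D < 0
  map_sqrt : ι δ = (Real.sqrt (-(D : ℝ)) : ℂ) * Complex.I
  mem_iff : ∀ z : K, z ∈ O ↔ ∃ m n : ℤ, z = m + n * (((D : K) + δ) / 2)
  exists_coord : ∀ z : K, ∃ x y : ℚ, z = x + y * δ
  basis : Nonempty (Module.Basis (Fin 2) ℤ O)

/-- Forms of discriminant `D`, without the condition at the level. -/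
theorem IsFormOf.one {D : ℤ} {N : ℕ} {Q : BinForm} (h : IsFormOf D N Q) : IsFormOf D 1 Q :=
  ⟨h.primitive, h.disc_eq, h.pos, by simp⟩

theorem IsFormOf.act_one {D : ℤ} (hD : D < 0) {Q : BinForm} (h : IsFormOf D 1 Q) (γ : SL(2, ℤ)) :
    IsFormOf D 1 (Q.act γ) :=
  ⟨h.primitive.act γ, by rw [BinForm.disc_act, h.disc_eq],
    BinForm.act_a_pos h.pos (by rw [h.disc_eq]; exact hD) γ, by simp⟩

theorem IsDirichletMiddle.isFormOf {D : ℤ} {Q Q'' : BinForm} {B : ℤ}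
    (h : IsDirichletMiddle D Q Q'' B) (hQ : IsFormOf D 1 Q) (hQ'' : IsFormOf D 1 Q'') :
    IsFormOf D 1 (dirichletComp D Q Q'' B) := by
  obtain ⟨X, Y, -, -, -, -, hd⟩ :=
    h.exists_eq hQ.disc_eq hQ''.disc_eq hQ.pos.ne' hQ''.pos.ne'
  exact ⟨BinForm.isPrimitive_dirichletComp h hQ.disc_eq hQ''.disc_eq hQ.pos.ne' hQ''.pos.ne'
    hQ.primitive hQ''.primitive, hd, mul_pos hQ.pos hQ''.pos, by simp⟩

namespace IsQuadOrder

variable {ι : K →+* ℂ} {O : Subring K} {D : ℤ} {δ : K}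

theorem sqrt_pos (h : IsQuadOrder ι O D δ) : 0 < Real.sqrt (-(D : ℝ)) :=
  Real.sqrt_pos.mpr (by have : (D : ℝ) < 0 := by exact_mod_cast h.neg
                        linarith)

theorem sq (h : IsQuadOrder ι O D δ) : δ ^ 2 = D := by
  apply ι.injective
  have h1 : (0 : ℝ) ≤ -(D : ℝ) := by
    have : (D : ℝ) < 0 := by exact_mod_cast h.neg
    linarith
  rw [map_pow, h.map_sqrt, mul_pow, Complex.I_sq, ← Complex.ofReal_pow, Real.sq_sqrt h1]
  simp

variable [CharZero K]

theorem im_coord (h : IsQuadOrder ι O D δ) (x y : ℚ) :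
    (ι ((x : K) + y * δ)).im = y * Real.sqrt (-(D : ℝ)) := by
  rw [map_add, map_mul, h.map_sqrt, map_ratCast, map_ratCast]
  simp

theorem coord_ext (h : IsQuadOrder ι O D δ) {x y x' y' : ℚ}
    (e : (x : K) + y * δ = x' + y' * δ) : x = x' ∧ y = y' := by
  have h1 := congrArg (fun z => (ι z).im) e
  simp only [h.im_coord] at h1
  have h2 : y = y' := by exact_mod_cast mul_right_cancel₀ h.sqrt_pos.ne' h1
  subst h2
  exact ⟨by exact_mod_cast add_right_cancel e, rfl⟩

theorem map_root (h : IsQuadOrder ι O D δ) {Q : BinForm} (hQ : Q.disc = D) :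
    ι (Q.root δ) = Q.omega := by
  simp only [BinForm.root, BinForm.omega, hQ, map_div₀, map_add, map_neg, map_mul, map_intCast,
    h.map_sqrt, map_ofNat]

theorem a_mul_root {Q : BinForm} (ha : Q.a ≠ 0) : 2 * (Q.a : K) * Q.root δ = -Q.b + δ := by
  have : (Q.a : K) ≠ 0 := by exact_mod_cast ha
  simp only [BinForm.root]
  field_simp

theorem root_ext (h : IsQuadOrder ι O D δ) {Q : BinForm} (ha : Q.a ≠ 0) {m n m' n' : ℤ}
    (e : (m : K) * Q.root δ + n = m' * Q.root δ + n') : m = m' ∧ n = n' := by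
  have ha' : (Q.a : K) ≠ 0 := by exact_mod_cast ha
  have e2 : (((2 * Q.a * n - m * Q.b : ℤ) : ℚ) : K) + ((m : ℚ) : K) * δ
      = ((2 * Q.a * n' - m' * Q.b : ℤ) : ℚ) + ((m' : ℚ) : K) * δ := by
    push_cast
    linear_combination 2 * (Q.a : K) * e + (m' - m) * a_mul_root (K := K) (δ := δ) ha
  obtain ⟨h1, h2⟩ := h.coord_ext e2
  have h2' : m = m' := by exact_mod_cast h2
  have h1' : 2 * Q.a * n - m * Q.b = 2 * Q.a * n' - m' * Q.b := by exact_mod_cast h1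
  refine ⟨h2', ?_⟩
  subst h2'
  have : 2 * Q.a * n = 2 * Q.a * n' := by linarith
  exact mul_left_cancel₀ (by simp [ha]) this

theorem root_quadratic (h : IsQuadOrder ι O D δ) {Q : BinForm} (hQ : IsFormOf D 1 Q) :
    (Q.a : K) * Q.root δ ^ 2 + Q.b * Q.root δ + Q.c = 0 := by
  have ha' : (Q.a : K) ≠ 0 := by exact_mod_cast hQ.pos.ne'
  have h1 : δ ^ 2 = (Q.b : K) ^ 2 - 4 * Q.a * Q.c := by
    rw [h.sq, ← hQ.disc_eq]
    simp [BinForm.disc]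
  apply mul_left_cancel₀ (mul_ne_zero (by norm_num : (4 : K) ≠ 0) ha')
  linear_combination (2 * (Q.a : K) * Q.root δ + Q.b + δ) *
    a_mul_root (K := K) (δ := δ) hQ.pos.ne' + h1

/-- The generators `(D + δ)/2` and `a ω_Q` differ by `(D + b)/2`, an integer because `D ≡ b²` modulo
4. -/
theorem mem_iff_form (h : IsQuadOrder ι O D δ) {Q : BinForm} (hQ : IsFormOf D 1 Q) (z : K) :
    z ∈ O ↔ ∃ m n : ℤ, z = m + n * (Q.a * Q.root δ) := by
  have hd := hQ.disc_eq
  unfold BinForm.disc at hd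
  obtain ⟨k, hk⟩ : (2 : ℤ) ∣ D + Q.b := by
    have : Even (D + Q.b) := by
      rw [← hd, sub_add_eq_add_sub, Int.even_sub]
      have h1 : Even (Q.b ^ 2 + Q.b) := by
        rw [show Q.b ^ 2 + Q.b = Q.b * (Q.b + 1) by ring]
        exact Int.even_mul_succ_self _
      have h2 : Even (4 * Q.a * Q.c) := ⟨2 * Q.a * Q.c, by ring⟩
      simp [h1, h2]
    exact this.two_dvd
  have hk' : (D : K) + Q.b = 2 * k := by exact_mod_cast hk
  have e : ((D : K) + δ) / 2 = Q.a * Q.root δ + k := by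
    have := a_mul_root (K := K) (δ := δ) hQ.pos.ne'
    linear_combination hk' / 2 - this / 2
  rw [h.mem_iff, e]
  constructor
  · rintro ⟨m, n, rfl⟩
    exact ⟨m + n * k, n, by push_cast; ring⟩
  · rintro ⟨m, n, rfl⟩
    exact ⟨m - n * k, n, by push_cast; ring⟩

theorem isFractionRing (h : IsQuadOrder ι O D δ) : IsFractionRing O K := by
  apply IsFractionRing.of_field
  intro z
  obtain ⟨x, y, rfl⟩ := h.exists_coord z
  have hδ : δ ∈ O := (h.mem_iff δ).mpr ⟨-D, 2, by push_cast; ring⟩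
  refine ⟨⟨(x.num * y.den : ℤ) + (y.num * x.den : ℤ) * δ,
    add_mem (intCast_mem O _) (mul_mem (intCast_mem O _) hδ)⟩,
    ⟨(x.den * y.den : ℤ), intCast_mem O _⟩, ?_⟩
  have h1 : (x.den : K) ≠ 0 := by exact_mod_cast x.den_ne_zero
  have h2 : (y.den : K) ≠ 0 := by exact_mod_cast y.den_ne_zero
  change _ = ((x.num * y.den : ℤ) + (y.num * x.den : ℤ) * δ : K) / ((x.den * y.den : ℤ) : K)
  rw [Rat.cast_def, Rat.cast_def]
  push_cast
  field_simp

/-- If `Q' = Q^γ`, then `γ` maps the zero of `Q'` to the zero of `Q`. -/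
theorem root_act (h : IsQuadOrder ι O D δ) {Q : BinForm} (hQ : IsFormOf D 1 Q) (γ : SL(2, ℤ)) :
    Q.root δ * ((γ 1 0 : K) * (Q.act γ).root δ + γ 1 1)
      = (γ 0 0 : K) * (Q.act γ).root δ + γ 0 1 := by
  have ha' : (Q.a : K) ≠ 0 := by exact_mod_cast hQ.pos.ne'
  have ha'' : ((Q.act γ).a : K) ≠ 0 := by exact_mod_cast (hQ.act_one h.neg γ).pos.ne'
  have h1 : δ ^ 2 = (Q.b : K) ^ 2 - 4 * Q.a * Q.c := by
    rw [h.sq, ← hQ.disc_eq]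
    simp [BinForm.disc]
  have hdet : (γ 0 0 : K) * γ 1 1 - γ 0 1 * γ 1 0 = 1 := by exact_mod_cast det_eq_one γ
  simp only [BinForm.root]
  field_simp
  simp only [BinForm.act]
  push_cast
  linear_combination (γ 1 0 : K) * h1 + ((δ - Q.b) * (2 * Q.a * γ 0 0 + Q.b * γ 1 0) +
    2 * Q.a * (Q.b * γ 0 0 + 2 * Q.c * γ 1 0)) * hdet

theorem factor_ne_zero (h : IsQuadOrder ι O D δ) {Q : BinForm} (hQ : IsFormOf D 1 Q)
    (γ : SL(2, ℤ)) : (γ 1 0 : K) * Q.root δ + γ 1 1 ≠ 0 := by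
  intro e
  obtain ⟨h1, h2⟩ := h.root_ext (m' := 0) (n' := 0) hQ.pos.ne' (by simpa using e)
  have := det_eq_one γ
  simp [h1, h2] at this

/-- A form is determined by its zero and its discriminant. -/
theorem eq_of_root_eq {Q Q' : BinForm} (h : IsQuadOrder ι O D δ) (hQ : IsFormOf D 1 Q)
    (hQ' : IsFormOf D 1 Q') (e : Q.root δ = Q'.root δ) : Q = Q' := by
  have h1 := a_mul_root (K := K) (δ := δ) hQ.pos.ne'
  have h2 := a_mul_root (K := K) (δ := δ) hQ'.pos.ne'
  rw [← e] at h2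
  obtain ⟨h3, h4⟩ := h.coord_ext (x := -Q.b * Q'.a) (y := Q'.a) (x' := -Q'.b * Q.a) (y' := Q.a)
    (by push_cast; linear_combination (Q.a : K) * h2 - Q'.a * h1)
  have h4' : Q'.a = Q.a := by exact_mod_cast h4
  have h3' : -Q.b * Q'.a = -Q'.b * Q.a := by exact_mod_cast h3
  have h5 : Q.b = Q'.b := by
    rw [h4'] at h3'
    have := mul_right_cancel₀ hQ.pos.ne' h3'
    linarith
  ext
  · exact h4'.symm
  · exact h5
  · have h6 := hQ.disc_eq
    rw [← hQ'.disc_eq] at h6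
    unfold BinForm.disc at h6
    rw [h5, h4'] at h6
    have : 4 * Q.a * Q.c = 4 * Q.a * Q'.c := by linarith
    exact mul_left_cancel₀ (by simp [hQ.pos.ne']) this

/-- The integers `u, v` of the unit relation are determined explicitly. -/
theorem isUnitRelation_iff (h : IsQuadOrder ι O D δ) {Q Q'' : BinForm} {γ : SL(2, ℤ)} {B Y : ℤ}
    (hQ : IsFormOf D 1 Q) (hQ'' : IsFormOf D 1 Q'') (hB : IsDirichletMiddle D Q Q'' B)
    (hY : B = Q''.b + 2 * Q''.a * Y) (u v : ℤ) :
    IsUnitRelation γ Q'' (dirichletComp D Q Q'' B) u v ↔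
      u = Q.a * γ 1 0 ∧ v = γ 1 1 + γ 1 0 * Y := by
  have hC := hB.isFormOf hQ hQ''
  set C := dirichletComp D Q Q'' B with hCdef
  have ha : (Q.a : K) ≠ 0 := by exact_mod_cast hQ.pos.ne'
  have ha'' : (Q''.a : K) ≠ 0 := by exact_mod_cast hQ''.pos.ne'
  -- The relation `B = b'' + 2a''Y` lets `j(γ, ω'')` be written in the basis `ω''', 1`; comparing
  -- coordinates yields `u` and `v`.
  have e : Q''.root δ = Q.a * C.root δ + Y := by
    have hY' : (B : K) = Q''.b + 2 * Q''.a * Y := by exact_mod_cast hY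
    simp only [BinForm.root, hCdef, dirichletComp]
    push_cast
    field_simp
    linear_combination hY'
  have hj := h.factor_ne_zero hQ'' γ
  have hι : autFactor γ Q''.omega = ι ((γ 1 0 : K) * Q''.root δ + γ 1 1) := by
    simp [autFactor, h.map_root hQ''.disc_eq]
  unfold IsUnitRelation
  rw [hι, ← h.map_root hC.disc_eq]
  have hj' : ι ((γ 1 0 : K) * Q''.root δ + γ 1 1) ≠ 0 := (map_ne_zero ι).mpr hj
  rw [← mul_div_assoc, mul_one_div, ← add_div, div_eq_one_iff_eq hj',
    show (u : ℂ) * ι (C.root δ) + v = ι (u * C.root δ + v) by simp, ι.injective.eq_iff, e,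
    show (γ 1 0 : K) * (Q.a * C.root δ + Y) + γ 1 1
      = ((Q.a * γ 1 0 : ℤ) : K) * C.root δ + ((γ 1 1 + γ 1 0 * Y : ℤ) : K) by push_cast; ring]
  constructor
  · exact h.root_ext hC.pos.ne'
  · rintro ⟨rfl, rfl⟩
    rfl

/-- In terms of zeros, the unit relation says `u ω''' + v = j(γ, ω'')`. -/
theorem factor_eq_of_isUnitRelation (h : IsQuadOrder ι O D δ) {Q'' C : BinForm} {γ : SL(2, ℤ)}
    {u v : ℤ} (hQ'' : IsFormOf D 1 Q'') (hC : IsFormOf D 1 C) (huv : IsUnitRelation γ Q'' C u v) :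
    (u : K) * C.root δ + v = (γ 1 0 : K) * Q''.root δ + γ 1 1 := by
  have hj := h.factor_ne_zero hQ'' γ
  have hj' : ι ((γ 1 0 : K) * Q''.root δ + γ 1 1) ≠ 0 := (map_ne_zero ι).mpr hj
  apply ι.injective
  have hι : autFactor γ Q''.omega = ι ((γ 1 0 : K) * Q''.root δ + γ 1 1) := by
    simp [autFactor, h.map_root hQ''.disc_eq]
  unfold IsUnitRelation at huv
  rw [hι, ← h.map_root hC.disc_eq, ← mul_div_assoc, mul_one_div, ← add_div,
    div_eq_one_iff_eq hj'] at huv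
  rw [← huv]
  simp

end IsQuadOrder

/-- For the `u, v` of the unit relation, substituting `ω'' = a ω''' + Y` turns `Q'''(v, -u)` into `a
Q''(s, -r)`, where `(r, s)` is the bottom row of `γ`. As `(s, -r)` is the first column of `γ⁻¹`, the
second factor is `a'`. The product is prime to `N`, which makes the last step of the composition
possible. -/
theorem IsDirichletMiddle.eval_eq {D : ℤ} {Q Q' : BinForm} {γ : SL(2, ℤ)} {B Y : ℤ}
    (hY : B = (Q'.act γ).b + 2 * (Q'.act γ).a * Y)
    (hc : Q.a * (dirichletComp D Q (Q'.act γ) B).c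
      = (Q'.act γ).c + (Q'.act γ).b * Y + (Q'.act γ).a * Y ^ 2) :
    (dirichletComp D Q (Q'.act γ) B).eval (γ 1 1 + γ 1 0 * Y) (-(Q.a * γ 1 0)) = Q.a * Q'.a := by
  have h1 : (Q'.act γ).eval (γ 1 1) (-γ 1 0) = Q'.a := by
    have h := BinForm.act_act_inv Q' γ
    have h2 := congrArg BinForm.a h
    rw [BinForm.act_a] at h2
    rw [← h2]
    simp [Matrix.SpecialLinearGroup.SL2_inv_expl]
  rw [← h1]
  simp only [BinForm.eval]
  have e1 : (dirichletComp D Q (Q'.act γ) B).a = Q.a * (Q'.act γ).a := rfl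
  have e2 : (dirichletComp D Q (Q'.act γ) B).b = (Q'.act γ).b + 2 * (Q'.act γ).a * Y := hY
  rw [e1, e2]
  linear_combination Q.a * (γ 1 0) ^ 2 * hc

/-- The form attached to a bottom row congruent to `(u, v)` has leading coefficient congruent to
`Q(v, -u)`. -/
theorem BottomRow.act_inv_a_modEq {N : ℕ} {σ : SL(2, ℤ)} {u v : ℤ} (h : BottomRow N σ u v)
    (C : BinForm) : (C.act σ⁻¹).a ≡ C.eval v (-u) [ZMOD N] := by
  have e : (C.act σ⁻¹).a = C.eval (σ 1 1) (-σ 1 0) := by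
    rw [BinForm.act_a]
    simp [Matrix.SpecialLinearGroup.SL2_inv_expl]
  rw [e]
  unfold BinForm.eval
  have h1 := h.1.neg
  have h2 := h.2
  gcongr

theorem BottomRow.isFormOf {D : ℤ} (hD : D < 0) {N : ℕ} {σ : SL(2, ℤ)} {u v : ℤ}
    (h : BottomRow N σ u v) {C : BinForm} (hC : IsFormOf D 1 C)
    (hco : Int.gcd (C.eval v (-u)) N = 1) : IsFormOf D N (C.act σ⁻¹) := by
  refine ⟨(hC.act_one hD _).primitive, (hC.act_one hD _).disc_eq, (hC.act_one hD _).pos, ?_⟩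
  obtain ⟨k, hk⟩ := Int.modEq_iff_dvd.mp (h.act_inv_a_modEq C).symm
  rw [← Int.isCoprime_iff_gcd_eq_one] at hco ⊢
  rw [show (C.act σ⁻¹).a = C.eval v (-u) + N * k by linarith]
  exact IsCoprime.add_mul_left_left_iff.mpr hco

end FormClassGroup

namespace FormClassGroup

open FractionalIdeal

variable {K : Type*} [Field K]

/-! ### Units among the fractional ideals -/

section Units

variable {O : Subring K}

theorem mem_one_iff_mem {z : K} : z ∈ (1 : FractionalIdeal O⁰ K) ↔ z ∈ O := by
  rw [FractionalIdeal.mem_one_iff]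
  exact ⟨fun ⟨x, hx⟩ => hx ▸ x.2, fun hz => ⟨⟨z, hz⟩, rfl⟩⟩

/-- Multiply `z I ⊆ I` by `I⁻¹` and apply the result to 1. -/
theorem mem_of_mul_mem_unit (I : IdealGroup O) {z : K}
    (h : ∀ x ∈ (I : FractionalIdeal O⁰ K), z * x ∈ (I : FractionalIdeal O⁰ K)) : z ∈ O := by
  have key : ∀ y ∈ (I : FractionalIdeal O⁰ K) * ((I⁻¹ : IdealGroup O) : FractionalIdeal O⁰ K),
      z * y ∈ (I : FractionalIdeal O⁰ K) * ((I⁻¹ : IdealGroup O) : FractionalIdeal O⁰ K) := by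
    intro y hy
    refine FractionalIdeal.mul_induction_on hy ?_ ?_
    · intro i hi j hj
      rw [← mul_assoc]
      exact FractionalIdeal.mul_mem_mul (h i hi) hj
    · intro x y hx hy
      rw [mul_add]
      exact Submodule.add_mem (_ : FractionalIdeal O⁰ K).coeToSubmodule hx hy
  rw [Units.mul_inv] at key
  have := key 1 (mem_one_iff_mem.mpr (one_mem O))
  rwa [mul_one, mem_one_iff_mem] at this

theorem isProperIdeal_of_unit (I : IdealGroup O) {𝔞 : Ideal O}
    (h : (I : FractionalIdeal O⁰ K) = (𝔞 : FractionalIdeal O⁰ K)) : IsProperIdeal O 𝔞 := by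
  ext β
  simp only [Set.mem_ofPred_eq, SetLike.mem_coe]
  constructor
  · intro hβ
    refine mem_of_mul_mem_unit I fun x hx => ?_
    rw [h, FractionalIdeal.mem_coeIdeal] at hx ⊢
    obtain ⟨x, hx, rfl⟩ := hx
    obtain ⟨y, hy, e⟩ := hβ x hx
    exact ⟨y, hy, e.symm⟩
  · intro hβ x hx
    exact ⟨⟨β, hβ⟩ * x, 𝔞.mul_mem_left _ hx, rfl⟩

theorem mem_idealsPrimeTo_of_le_one {N : ℕ} (I : IdealGroup O)
    (h : (I : FractionalIdeal O⁰ K) ≤ 1) {n : ℤ} (hn : Int.gcd n N = 1)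
    (hnI : (n : K) ∈ (I : FractionalIdeal O⁰ K)) : I ∈ idealsPrimeTo O N := by
  obtain ⟨𝔞, h𝔞⟩ := FractionalIdeal.le_one_iff_exists_coeIdeal.mp h
  refine Subgroup.subset_closure ⟨𝔞, ?_, isProperIdeal_of_unit I h𝔞.symm, ?_, h𝔞.symm⟩
  · rintro rfl
    rw [FractionalIdeal.coeIdeal_bot] at h𝔞
    exact I.ne_zero h𝔞.symm
  · rw [← h𝔞, FractionalIdeal.mem_coeIdeal] at hnI
    obtain ⟨x, hx, e⟩ := hnI
    have hx' : x = (n : O) := Subtype.ext (by rw [Subring.coe_intCast]; exact e)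
    subst hx'
    obtain ⟨s, t, hst⟩ := Int.isCoprime_iff_gcd_eq_one.mpr hn
    rw [Ideal.eq_top_iff_one]
    have h1 : (1 : O) = s * n + t * N := by exact_mod_cast congrArg (Int.cast (R := O)) hst.symm
    rw [h1]
    exact Ideal.add_mem _ (Ideal.mem_sup_left (Ideal.mul_mem_left _ _ hx))
      (Ideal.mem_sup_right (Ideal.mul_mem_left _ _ (Ideal.mem_span_singleton_self _)))

theorem intCast_mul_mem {I : FractionalIdeal O⁰ K} {z : K} (hz : z ∈ I) (n : ℤ) :
    (n : K) * z ∈ I := by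
  have := I.coeToSubmodule.smul_mem (n : O) hz
  rwa [Subring.smul_def, Subring.coe_intCast, smul_eq_mul] at this

theorem mul_add_mul_mem {I : FractionalIdeal O⁰ K} {x y : K} (hx : x ∈ I) (hy : y ∈ I) (m n : ℤ) :
    (m : K) * x + n * y ∈ I :=
  I.coeToSubmodule.add_mem (intCast_mul_mem hx m) (intCast_mul_mem hy n)

variable [IsFractionRing O K]

theorem principal_mem_principalRay {N : ℕ} {ν : Kˣ} (hν : (ν : K) ∈ O)
    (h : ∃ β ∈ O, (ν : K) = 1 + N * β) : toPrincipalIdeal O K ν ∈ principalRay O N := by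
  obtain ⟨β, hβ, e⟩ := h
  refine Subgroup.subset_closure ⟨⟨ν, hν⟩, ?_, ?_, ?_⟩
  · intro h0
    exact ν.ne_zero (congrArg Subtype.val h0)
  · refine Ideal.mem_span_singleton.mpr ⟨⟨β, hβ⟩, Subtype.ext ?_⟩
    push_cast
    rw [e]
    ring
  · rw [coe_toPrincipalIdeal, FractionalIdeal.coeIdeal_span_singleton]
    rfl

/-- The ideal generated by `1 + N β` lies in the ray if `β` has a denominator prime to `N`. -/
theorem principal_mem_principalRay_of_denom [CharZero K] {N : ℕ} {ν : Kˣ} {m : ℤ} {β : K}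
    (hm : Int.gcd m N = 1) (hm0 : m ≠ 0) (hβ : m * β ∈ O) (e : (ν : K) = 1 + N * β) :
    toPrincipalIdeal O K ν ∈ principalRay O N := by
  obtain ⟨s, t, hst⟩ := Int.isCoprime_iff_gcd_eq_one.mpr hm
  -- Here `k` is a nonzero inverse of `m` modulo `N`, so `k m` and `k m ν` both generate ray ideals,
  -- and `ν` is their quotient. The Bézout coefficient `s` can vanish only when `N = 1`; then `k =
  -- m` serves.
  obtain ⟨k, hk0, hk⟩ : ∃ k : ℤ, k * m ≠ 0 ∧ ∃ l : ℤ, k * m = 1 + N * l := by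
    by_cases hs : s = 0
    · subst hs
      exact ⟨m, mul_ne_zero hm0 hm0, (m ^ 2 - 1) * t, by linear_combination -(m ^ 2 - 1) * hst⟩
    · exact ⟨s, mul_ne_zero hs hm0, -t, by linear_combination hst⟩
  obtain ⟨l, hl⟩ := hk
  have hl' : (k : K) * m = 1 + N * l := by exact_mod_cast hl
  have hk0' : ((k * m : ℤ) : K) ≠ 0 := by exact_mod_cast hk0
  have h1 : toPrincipalIdeal O K (Units.mk0 _ hk0') ∈ principalRay O N := by
    refine principal_mem_principalRay (intCast_mem O _) ⟨l, intCast_mem O _, ?_⟩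
    rw [Units.val_mk0]
    push_cast
    exact hl'
  have hkβ : (k : K) * (m * β) ∈ O := mul_mem (intCast_mem O _) hβ
  have h2 : toPrincipalIdeal O K (Units.mk0 _ hk0' * ν) ∈ principalRay O N := by
    have e2 : ((Units.mk0 _ hk0' * ν : Kˣ) : K) = 1 + N * (l + k * (m * β)) := by
      rw [Units.val_mul, Units.val_mk0, e]
      push_cast
      linear_combination hl'
    have hO : (l : K) + k * (m * β) ∈ O := add_mem (intCast_mem O _) hkβ
    refine principal_mem_principalRay ?_ ⟨_, hO, e2⟩
    rw [e2]
    exact add_mem (one_mem O) (mul_mem (natCast_mem O _) hO)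
  rw [map_mul] at h2
  exact (Subgroup.mul_mem_cancel_left _ h1).mp h2

/-- Numbers of the form `1 + N β` with `β ∈ O` are closed under products, so each element of the
generated subgroup is a single quotient of two of them. -/
theorem exists_of_mem_principalRay {N : ℕ} {I : IdealGroup O} (hI : I ∈ principalRay O N) :
    ∃ μ ν : Kˣ, (∃ β ∈ O, (μ : K) = 1 + N * β) ∧ (∃ β ∈ O, (ν : K) = 1 + N * β) ∧
      I * toPrincipalIdeal O K ν = toPrincipalIdeal O K μ := by
  have hmul : ∀ x y : K, (∃ β ∈ O, x = 1 + N * β) → (∃ β ∈ O, y = 1 + N * β) →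
      ∃ β ∈ O, x * y = 1 + N * β := by
    rintro _ _ ⟨β, hβ, rfl⟩ ⟨β', hβ', rfl⟩
    exact ⟨β + β' + N * β * β', add_mem (add_mem hβ hβ')
      (mul_mem (mul_mem (natCast_mem O _) hβ) hβ'), by ring⟩
  refine Subgroup.closure_induction ?_ ?_ ?_ ?_ hI
  · rintro I ⟨ν, h0, h1, e⟩
    have hν : (ν : K) ≠ 0 := fun h => h0 (Subtype.ext h)
    obtain ⟨β, hβ⟩ := Ideal.mem_span_singleton.mp h1
    refine ⟨Units.mk0 _ hν, 1, ⟨β, β.2, ?_⟩, ⟨0, zero_mem O, by simp⟩, ?_⟩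
    · have := congrArg Subtype.val hβ
      push_cast at this
      rw [Units.val_mk0]
      linear_combination this
    · rw [map_one, mul_one]
      ext1
      rw [e, coe_toPrincipalIdeal, FractionalIdeal.coeIdeal_span_singleton]
      rfl
  · exact ⟨1, 1, ⟨0, zero_mem O, by simp⟩, ⟨0, zero_mem O, by simp⟩, by simp⟩
  · rintro I J - - ⟨μ, ν, h1, h2, e⟩ ⟨μ', ν', h1', h2', e'⟩
    refine ⟨μ * μ', ν * ν', hmul _ _ h1 h1', hmul _ _ h2 h2', ?_⟩
    rw [map_mul, map_mul, ← e, ← e', mul_mul_mul_comm]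
  · rintro I - ⟨μ, ν, h1, h2, e⟩
    refine ⟨ν, μ, h2, h1, ?_⟩
    rw [← e, inv_mul_cancel_left]

end Units

/-! ### The lattice of a form -/

namespace IsQuadOrder

variable [CharZero K] {ι : K →+* ℂ} {O : Subring K} {D : ℤ} {δ : K}

/-- The fractional ideal `[ω_Q, 1]`. -/
def formIdeal (h : IsQuadOrder ι O D δ) {Q : BinForm} (hQ : IsFormOf D 1 Q) :
    FractionalIdeal O⁰ K :=
  ⟨{ carrier := {z | ∃ m n : ℤ, z = m * Q.root δ + n}
     zero_mem' := ⟨0, 0, by simp⟩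
     add_mem' := by
       rintro _ _ ⟨m, n, rfl⟩ ⟨m', n', rfl⟩
       exact ⟨m + m', n + n', by push_cast; ring⟩
     smul_mem' := by
       rintro ⟨c, hc⟩ _ ⟨m, n, rfl⟩
       obtain ⟨x, y, rfl⟩ := (h.mem_iff_form hQ c).mp hc
       refine ⟨x * m + y * Q.a * n - y * m * Q.b, x * n - y * m * Q.c, ?_⟩
       change (x + y * (Q.a * Q.root δ) : K) * (m * Q.root δ + n) = _
       push_cast
       linear_combination (y * m : K) * h.root_quadratic hQ },
   by
     refine ⟨(Q.a : O), mem_nonZeroDivisors_of_ne_zero ?_, ?_⟩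
     · intro h0
       have : (Q.a : K) = 0 := by simpa using congrArg Subtype.val h0
       exact hQ.pos.ne' (by exact_mod_cast this)
     · rintro _ ⟨m, n, rfl⟩
       have : (Q.a : K) * (m * Q.root δ + n) ∈ O :=
         (h.mem_iff_form hQ _).mpr ⟨Q.a * n, m, by push_cast; ring⟩
       exact ⟨⟨_, this⟩, by simp [Subring.smul_def, Algebra.algebraMap_eq_smul_one, mul_add]⟩⟩

theorem mem_formIdeal (h : IsQuadOrder ι O D δ) {Q : BinForm} (hQ : IsFormOf D 1 Q) {z : K} :
    z ∈ h.formIdeal hQ ↔ ∃ m n : ℤ, z = m * Q.root δ + n := Iff.rfl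

theorem one_mem_formIdeal (h : IsQuadOrder ι O D δ) {Q : BinForm} (hQ : IsFormOf D 1 Q) :
    (1 : K) ∈ h.formIdeal hQ := (h.mem_formIdeal hQ).mpr ⟨0, 1, by simp⟩

theorem root_mem_formIdeal (h : IsQuadOrder ι O D δ) {Q : BinForm} (hQ : IsFormOf D 1 Q) :
    Q.root δ ∈ h.formIdeal hQ := (h.mem_formIdeal hQ).mpr ⟨1, 0, by simp⟩

theorem formIdeal_le (h : IsQuadOrder ι O D δ) {Q : BinForm} (hQ : IsFormOf D 1 Q)
    {I : FractionalIdeal O⁰ K} (h1 : Q.root δ ∈ I) (h2 : (1 : K) ∈ I) : h.formIdeal hQ ≤ I := by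
  rintro _ ⟨m, n, rfl⟩
  simpa using mul_add_mul_mem h1 h2 m n

/-- Multiplying the basis `ω_Q, 1` by `j(γ, ω_{Q^γ})` gives `p ω + q, r ω + s` with `ω = ω_{Q^γ}`,
which spans `[ω, 1]` because `γ` is invertible over `ℤ`. -/
theorem formIdeal_act [IsFractionRing O K] (h : IsQuadOrder ι O D δ) {Q : BinForm}
    (hQ : IsFormOf D 1 Q) (γ : SL(2, ℤ)) :
    h.formIdeal (hQ.act_one h.neg γ) =
      spanSingleton O⁰ ((γ 1 0 : K) * (Q.act γ).root δ + γ 1 1) * h.formIdeal hQ := by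
  have hr := h.root_act hQ γ
  have hdet : (γ 0 0 : K) * γ 1 1 - γ 0 1 * γ 1 0 = 1 := by exact_mod_cast det_eq_one γ
  apply le_antisymm
  · apply formIdeal_le
    · refine mem_singleton_mul.mpr ⟨_, (h.mem_formIdeal hQ).mpr ⟨γ 1 1, -γ 0 1, rfl⟩, ?_⟩
      push_cast
      linear_combination -(γ 1 1 : K) * hr - (Q.act γ).root δ * hdet
    · refine mem_singleton_mul.mpr ⟨_, (h.mem_formIdeal hQ).mpr ⟨-γ 1 0, γ 0 0, rfl⟩, ?_⟩
      push_cast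
      linear_combination (γ 1 0 : K) * hr - hdet
  · intro z hz
    obtain ⟨_, ⟨m, n, rfl⟩, rfl⟩ := mem_singleton_mul.mp hz
    refine ⟨m * γ 0 0 + n * γ 1 0, m * γ 0 1 + n * γ 1 1, ?_⟩
    push_cast
    linear_combination (m : K) * hr

/-- With `ω` the zero of the composite, the two lattices are `[a''ω, 1]` and `[aω, 1]`. As `a a'' ω²
= -Bω - c`, their product is spanned by 1 and the multiples of `ω` by `a`, `a''` and `B`;
concordance makes these three integers coprime. -/
theorem formIdeal_mul (h : IsQuadOrder ι O D δ) {Q Q'' : BinForm} {B : ℤ}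
    (hQ : IsFormOf D 1 Q) (hQ'' : IsFormOf D 1 Q'') (hc : Concordant Q Q'')
    (hB : IsDirichletMiddle D Q Q'' B) :
    h.formIdeal hQ * h.formIdeal hQ'' = h.formIdeal (hB.isFormOf hQ hQ'') := by
  have hC := hB.isFormOf hQ hQ''
  obtain ⟨X, Y, hX, hY, -, -, -⟩ := hB.exists_eq hQ.disc_eq hQ''.disc_eq hQ.pos.ne' hQ''.pos.ne'
  have hquad := h.root_quadratic hC
  have ha : (Q.a : K) ≠ 0 := by exact_mod_cast hQ.pos.ne'
  have ha'' : (Q''.a : K) ≠ 0 := by exact_mod_cast hQ''.pos.ne'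
  have hX' : (B : K) = Q.b + 2 * Q.a * X := by exact_mod_cast hX
  have hY' : (B : K) = Q''.b + 2 * Q''.a * Y := by exact_mod_cast hY
  have ea : ((dirichletComp D Q Q'' B).a : K) = Q.a * Q''.a := by simp [dirichletComp]
  have eb : ((dirichletComp D Q Q'' B).b : K) = B := by simp [dirichletComp]
  have e1 : Q.root δ = Q''.a * (dirichletComp D Q Q'' B).root δ + X := by
    simp only [BinForm.root, ea, eb]
    field_simp
    linear_combination hX'
  have e2 : Q''.root δ = Q.a * (dirichletComp D Q Q'' B).root δ + Y := by
    simp only [BinForm.root, ea, eb]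
    field_simp
    linear_combination hY'
  rw [ea, eb] at hquad
  obtain ⟨x, y, z, hxyz⟩ : ∃ x y z : ℤ, x * Q.a + y * Q''.a + z * B = 1 := by
    have hs : B = (Q.b + Q''.b) / 2 + Q.a * X + Q''.a * Y := by
      have : Q.b + Q''.b = 2 * (B - Q.a * X - Q''.a * Y) := by linarith
      rw [this, Int.mul_ediv_cancel_left _ two_ne_zero]
      ring
    obtain ⟨u, v, w, huvw⟩ := BinForm.exists_bezout_of_gcd_eq_one hc
    exact ⟨u - w * X, v - w * Y, w, by rw [hs]; linear_combination huvw⟩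
  have hxyz' : (x : K) * Q.a + y * Q''.a + z * B = 1 := by exact_mod_cast hxyz
  set C := dirichletComp D Q Q'' B with hCdef
  set ω := C.root δ with hω
  apply le_antisymm
  · rw [FractionalIdeal.mul_le]
    rintro _ ⟨m, n, rfl⟩ _ ⟨m', n', rfl⟩
    refine ⟨-m * m' * B + m * Q''.a * (m' * Y + n') + m' * Q.a * (m * X + n),
      -m * m' * C.c + (m * X + n) * (m' * Y + n'), ?_⟩
    rw [e1, e2]
    push_cast
    linear_combination (m * m' : K) * hquad
  · have m1 := mul_mem_mul (h.root_mem_formIdeal hQ) (h.one_mem_formIdeal hQ'')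
    have m2 := mul_mem_mul (h.one_mem_formIdeal hQ) (h.root_mem_formIdeal hQ'')
    have m3 := mul_mem_mul (h.root_mem_formIdeal hQ) (h.root_mem_formIdeal hQ'')
    have m4 := mul_mem_mul (h.one_mem_formIdeal hQ) (h.one_mem_formIdeal hQ'')
    rw [one_mul] at m4
    apply formIdeal_le _ _ _ m4
    have := mul_add_mul_mem (mul_add_mul_mem (mul_add_mul_mem m1 m2 (y + z * Y) (x + z * X)) m3 1 (-z))
      m4 1 (-(y + z * Y) * X - (x + z * X) * Y + z * (X * Y - C.c))
    convert this using 1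
    rw [e1, e2]
    push_cast
    linear_combination -ω * hxyz' + (z : K) * hquad

/-- The form `a x² - b x y + c y²`. -/
def _root_.FormClassGroup.BinForm.conj (Q : BinForm) : BinForm := ⟨Q.a, -Q.b, Q.c⟩

theorem _root_.FormClassGroup.IsFormOf.conj {N : ℕ} {Q : BinForm} (hQ : IsFormOf D N Q) :
    IsFormOf D N Q.conj where
  primitive := by
    rw [BinForm.isPrimitive_iff]
    intro d h1 h2 h3
    exact (BinForm.isPrimitive_iff Q).mp hQ.primitive d h1 (dvd_neg.mp h2) h3
  disc_eq := by
    rw [← hQ.disc_eq]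
    simp [BinForm.disc, BinForm.conj]
  pos := hQ.pos
  coprime := hQ.coprime

variable [IsFractionRing O K]

/-- The conjugate form has `a` times its zero equal to `aω + b`, and `ω (aω + b) = -c`. The product
is thus spanned by `a`, `b`, `c` and `aω`, which by primitivity is `O`. This is where invertibility
of form lattices comes from. -/
theorem formIdeal_mul_conj (h : IsQuadOrder ι O D δ) {Q : BinForm} (hQ : IsFormOf D 1 Q) :
    h.formIdeal hQ * (spanSingleton O⁰ (Q.a : K) * h.formIdeal hQ.conj) = 1 := by
  have ha : (Q.a : K) ≠ 0 := by exact_mod_cast hQ.pos.ne'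
  have e1 : Q.a * Q.conj.root δ = Q.b + Q.a * Q.root δ := by
    simp only [BinForm.root, BinForm.conj]
    push_cast
    field_simp
    ring
  have hquad := h.root_quadratic hQ
  obtain ⟨x, y, z, hxyz⟩ := BinForm.exists_bezout_of_gcd_eq_one hQ.primitive
  have hxyz' : (x : K) * Q.a + y * Q.b + z * Q.c = 1 := by exact_mod_cast hxyz
  set ω := Q.root δ with hω
  apply le_antisymm
  · rw [FractionalIdeal.mul_le]
    rintro _ ⟨m, n, rfl⟩ w hw
    obtain ⟨_, ⟨m', n', rfl⟩, rfl⟩ := mem_singleton_mul.mp hw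
    rw [mem_one_iff_mem, h.mem_iff_form hQ]
    refine ⟨-m * m' * Q.c + n * (m' * Q.b + n' * Q.a), m * n' + n * m', ?_⟩
    push_cast
    linear_combination (m * m' : K) * hquad + ((m : K) * ω + n) * m' * e1
  · rw [FractionalIdeal.one_le]
    have hm : ∀ w ∈ h.formIdeal hQ.conj, (Q.a : K) * w ∈
        spanSingleton O⁰ (Q.a : K) * h.formIdeal hQ.conj :=
      fun w hw => mem_singleton_mul.mpr ⟨w, hw, rfl⟩
    have m1 := mul_mem_mul (h.one_mem_formIdeal hQ) (hm _ (h.one_mem_formIdeal hQ.conj))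
    have m2 := mul_mem_mul (h.one_mem_formIdeal hQ) (hm _ (h.root_mem_formIdeal hQ.conj))
    have m3 := mul_mem_mul (h.root_mem_formIdeal hQ) (hm _ (h.root_mem_formIdeal hQ.conj))
    have m4 := mul_mem_mul (h.root_mem_formIdeal hQ) (hm _ (h.one_mem_formIdeal hQ.conj))
    have := mul_add_mul_mem (mul_add_mul_mem (mul_add_mul_mem m1 m2 x y) m3 1 (-z)) m4 1 (-y)
    convert this using 1
    push_cast
    rw [e1]
    linear_combination -hxyz' + (z : K) * hquad

/-- The lattice `[ω_Q, 1]` as an element of the group of ideals. -/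
noncomputable def formUnit (h : IsQuadOrder ι O D δ) {Q : BinForm} (hQ : IsFormOf D 1 Q) :
    IdealGroup O :=
  Units.mkOfMulEqOne _ _ (h.formIdeal_mul_conj hQ)

@[simp]
theorem coe_formUnit (h : IsQuadOrder ι O D δ) {Q : BinForm} (hQ : IsFormOf D 1 Q) :
    (h.formUnit hQ : FractionalIdeal O⁰ K) = h.formIdeal hQ := rfl

/-- The lattice is the quotient of `a [ω_Q, 1]` by `a O`; both are integral and contain `a`, which
is prime to `N`. -/
theorem formUnit_mem {N : ℕ} (h : IsQuadOrder ι O D δ) {Q : BinForm} (hQ : IsFormOf D N Q) :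
    h.formUnit hQ.one ∈ idealsPrimeTo O N := by
  have ha : (Q.a : K) ≠ 0 := by exact_mod_cast hQ.pos.ne'
  have h1 : toPrincipalIdeal O K (Units.mk0 _ ha) ∈ idealsPrimeTo O N := by
    refine mem_idealsPrimeTo_of_le_one _ ?_ hQ.coprime ?_
    · rw [coe_toPrincipalIdeal, spanSingleton_le_iff_mem, mem_one_iff_mem]
      exact intCast_mem O _
    · rw [coe_toPrincipalIdeal]
      exact mem_spanSingleton_self _ _
  have h2 : toPrincipalIdeal O K (Units.mk0 _ ha) * h.formUnit hQ.one ∈ idealsPrimeTo O N := by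
    refine mem_idealsPrimeTo_of_le_one _ ?_ hQ.coprime ?_
    · intro z hz
      rw [Units.val_mul, coe_toPrincipalIdeal] at hz
      obtain ⟨_, ⟨m, n, rfl⟩, rfl⟩ := mem_singleton_mul.mp hz
      rw [Units.val_mk0, mem_one_iff_mem, h.mem_iff_form hQ.one]
      exact ⟨Q.a * n, m, by push_cast; ring⟩
    · rw [Units.val_mul, coe_toPrincipalIdeal]
      exact mem_singleton_mul.mpr ⟨1, h.one_mem_formIdeal hQ.one, by simp⟩
  exact (Subgroup.mul_mem_cancel_left _ h1).mp h2

end IsQuadOrder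

end FormClassGroup

/-! ### Ray classes of form lattices: invariance, composition, injectivity -/

namespace FormClassGroup

open FractionalIdeal

theorem rayClassGroup_mk_eq_iff {K : Type*} [Field K] {O : Subring K} {N : ℕ} {I J : idealsPrimeTo O N} :
    (QuotientGroup.mk I : RayClassGroup O N) = QuotientGroup.mk J ↔
      (I.1)⁻¹ * J.1 ∈ principalRay O N := by
  rw [QuotientGroup.eq, Subgroup.mem_subgroupOf]
  rfl

variable {K : Type*} [Field K] [CharZero K] {ι : K →+* ℂ} {O : Subring K} {D : ℤ} {δ : K}

namespace IsQuadOrder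

theorem _root_.Complex.im_mul_normSq_of_moebius {z z' : ℂ} {p q r s : ℝ}
    (e : z' * (r * z + s) = p * z + q) :
    z'.im * Complex.normSq (r * z + s) = (p * s - q * r) * z.im := by
  have h1 := congrArg (fun w => (w * (starRingEnd ℂ) (r * z + s)).im) e
  simp only [mul_assoc, Complex.mul_conj] at h1
  rw [Complex.im_mul_ofReal] at h1
  rw [h1]
  simp
  ring

theorem root_im_pos (h : IsQuadOrder ι O D δ) {Q : BinForm} (hQ : IsFormOf D 1 Q) :
    0 < (ι (Q.root δ)).im := by
  rw [h.map_root hQ.disc_eq]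
  exact Q.omega_im_pos hQ.pos (by rw [hQ.disc_eq]; exact h.neg)

theorem a_mul_mem (h : IsQuadOrder ι O D δ) {Q : BinForm} (hQ : IsFormOf D 1 Q) {z : K}
    (hz : z ∈ h.formIdeal hQ) : (Q.a : K) * z ∈ O := by
  obtain ⟨m, n, rfl⟩ := hz
  exact (h.mem_iff_form hQ _).mpr ⟨Q.a * n, m, by push_cast; ring⟩

theorem a_mul_a_mul_mem (h : IsQuadOrder ι O D δ) {Q Q' : BinForm} (hQ : IsFormOf D 1 Q)
    (hQ' : IsFormOf D 1 Q') {z : K} (hz : z ∈ h.formIdeal hQ * h.formIdeal hQ') :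
    (Q.a * Q'.a : K) * z ∈ O := by
  refine FractionalIdeal.mul_induction_on hz ?_ ?_
  · intro x hx y hy
    rw [mul_mul_mul_comm]
    exact mul_mem (h.a_mul_mem hQ hx) (h.a_mul_mem hQ' hy)
  · intro x y hx hy
    rw [mul_add]
    exact add_mem hx hy

variable [IsFractionRing O K]

theorem formUnit_of_eq_act (h : IsQuadOrder ι O D δ) {C R : BinForm} (hC : IsFormOf D 1 C)
    (hR : IsFormOf D 1 R) {σ : SL(2, ℤ)} (e : C = R.act σ) :
    h.formUnit hC = toPrincipalIdeal O K (Units.mk0 _ (h.factor_ne_zero hC σ)) * h.formUnit hR := by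
  subst e
  ext1
  rw [Units.val_mul, coe_toPrincipalIdeal]
  exact h.formIdeal_act hR σ

theorem formUnit_mul (h : IsQuadOrder ι O D δ) {Q Q'' : BinForm} {B : ℤ}
    (hQ : IsFormOf D 1 Q) (hQ'' : IsFormOf D 1 Q'') (hc : Concordant Q Q'')
    (hB : IsDirichletMiddle D Q Q'' B) :
    h.formUnit hQ * h.formUnit hQ'' = h.formUnit (hB.isFormOf hQ hQ'') := by
  ext1
  exact h.formIdeal_mul hQ hQ'' hc hB

variable {N : ℕ}

/-- The class of `[ω_Q, 1]` in the ray class group. -/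
noncomputable def rayClass (h : IsQuadOrder ι O D δ) (Q : Forms D N) : RayClassGroup O N :=
  QuotientGroup.mk ⟨h.formUnit Q.2.one, h.formUnit_mem Q.2⟩

/-- The lattices differ by `j(γ, ω) = 1 + N (r ω + s)`, with `ω` the zero of `Q'`, and the leading
coefficient of `Q'` is a denominator prime to `N`. -/
theorem rayClass_eq_of_rel (h : IsQuadOrder ι O D δ) {Q Q' : Forms D N}
    (e : formSetoid D N Q Q') : h.rayClass Q = h.rayClass Q' := by
  obtain ⟨γ, hγ, e⟩ := e
  rw [rayClass, rayClass, rayClassGroup_mk_eq_iff]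
  change (h.formUnit Q.2.one)⁻¹ * h.formUnit Q'.2.one ∈ _
  rw [h.formUnit_of_eq_act Q'.2.one Q.2.one e, mul_left_comm, inv_mul_cancel, mul_one]
  rw [CongruenceSubgroup.Gamma1_mem] at hγ
  obtain ⟨-, h2, h3⟩ := hγ
  obtain ⟨r, hr⟩ := (ZMod.intCast_zmod_eq_zero_iff_dvd _ N).mp h3
  obtain ⟨s, hs⟩ := (ZMod.intCast_eq_intCast_iff_dvd_sub 1 (γ 1 1) N).mp (by simpa using h2.symm)
  refine principal_mem_principalRay_of_denom Q'.2.coprime Q'.2.pos.ne'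
    (h.a_mul_mem Q'.2.one ((h.mem_formIdeal _).mpr ⟨r, s, rfl⟩)) ?_
  have hs' : γ 1 1 = 1 + N * s := by linarith
  rw [Units.val_mk0, hr, hs']
  push_cast
  ring

/-- The two ideals differ by `j(σ, ω''') / j(γ, ω'')`. Its denominator is `u ω''' + v` and its
numerator has coefficients congruent to `u, v`, so the quotient is `1 + N β` with `β = (r ω''' + s)
/ j(γ, ω'')`, where `r, s` are now the quotients by `N` of the differences. -/
theorem rayClass_comp (h : IsQuadOrder ι O D δ) {Q Q' : Forms D N} {γ σ : SL(2, ℤ)} {B u v : ℤ}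
    (hc : Concordant Q.1 (Q'.1.act γ)) (hB : IsDirichletMiddle D Q.1 (Q'.1.act γ) B)
    (huv : IsUnitRelation γ (Q'.1.act γ) (dirichletComp D Q.1 (Q'.1.act γ) B) u v)
    (hσ : BottomRow N σ u v)
    (hR : IsFormOf D N ((dirichletComp D Q.1 (Q'.1.act γ) B).act σ⁻¹)) :
    h.rayClass ⟨_, hR⟩ = h.rayClass Q * h.rayClass Q' := by
  have hQ'' := Q'.2.one.act_one h.neg γ
  have hC := hB.isFormOf Q.2.one hQ''
  have e1 := h.formUnit_of_eq_act hQ'' Q'.2.one rfl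
  have e2 := h.formUnit_mul Q.2.one hQ'' hc hB
  have e3 := h.formUnit_of_eq_act hC hR.one (BinForm.act_inv_act _ σ).symm
  have hj := h.factor_eq_of_isUnitRelation hQ'' hC huv
  rw [rayClass, rayClass, rayClass, ← QuotientGroup.mk_mul, rayClassGroup_mk_eq_iff]
  change (h.formUnit hR.one)⁻¹ * (h.formUnit Q.2.one * h.formUnit Q'.2.one) ∈ _
  set jγ : Kˣ := Units.mk0 _ (h.factor_ne_zero hQ'' γ)
  set jσ : Kˣ := Units.mk0 _ (h.factor_ne_zero hC σ)
  have e4 : (h.formUnit hR.one)⁻¹ * (h.formUnit Q.2.one * h.formUnit Q'.2.one)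
      = toPrincipalIdeal O K (jσ / jγ) := by
    rw [map_div, eq_div_iff_mul_eq']
    rw [e1, e3] at e2
    calc _ = (h.formUnit hR.one)⁻¹ * (h.formUnit Q.2.one *
          (toPrincipalIdeal O K jγ * h.formUnit Q'.2.one)) := by
          rw [mul_assoc, mul_assoc (h.formUnit Q.2.one), mul_comm (h.formUnit Q'.2.one)]
      _ = _ := by rw [e2, mul_left_comm, inv_mul_cancel, mul_one]
  rw [e4]
  obtain ⟨r, hr⟩ := Int.modEq_iff_dvd.mp hσ.1.symm
  obtain ⟨s, hs⟩ := Int.modEq_iff_dvd.mp hσ.2.symm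
  set C := dirichletComp D Q.1 (Q'.1.act γ) B
  -- Dividing `[ω''', 1]` by `j(γ, ω'')` gives the product of the original lattices, so `a a'`
  -- clears the denominator of `β`.
  have hβ : ((r : K) * C.root δ + s) / jγ ∈ h.formIdeal Q.2.one * h.formIdeal Q'.2.one := by
    have e5 : spanSingleton O⁰ (jγ : K) * (h.formIdeal Q.2.one * h.formIdeal Q'.2.one)
        = h.formIdeal hC := by
      have := congrArg Units.val e2
      rw [e1] at this
      rw [← coe_formUnit h hC, ← this, Units.val_mul, Units.val_mul, coe_toPrincipalIdeal,
        mul_left_comm]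
      rfl
    have h6 : (r : K) * C.root δ + s ∈ h.formIdeal hC := ⟨r, s, rfl⟩
    rw [← e5] at h6
    obtain ⟨y, hy, h7⟩ := mem_singleton_mul.mp h6
    rw [h7, mul_div_cancel_left₀ _ jγ.ne_zero]
    exact hy
  have hm := h.a_mul_a_mul_mem Q.2.one Q'.2.one hβ
  refine principal_mem_principalRay_of_denom (m := Q.1.a * Q'.1.a) ?_
    (mul_ne_zero Q.2.pos.ne' Q'.2.pos.ne') (by push_cast; exact hm) ?_
  · rw [← Int.isCoprime_iff_gcd_eq_one]
    exact (Int.isCoprime_iff_gcd_eq_one.mpr Q.2.coprime).mul_left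
      (Int.isCoprime_iff_gcd_eq_one.mpr Q'.2.coprime)
  · have hr' : σ 1 0 = u + N * r := by linarith
    have hs' : σ 1 1 = v + N * s := by linarith
    have vσ : (jσ : K) = (σ 1 0 : K) * C.root δ + σ 1 1 := rfl
    have vγ : (jγ : K) = u * C.root δ + v := hj.symm
    rw [Units.val_div_eq_div_val, div_eq_iff jγ.ne_zero, add_mul, mul_assoc,
      div_mul_cancel₀ _ jγ.ne_zero, vσ, vγ, hr', hs']
    push_cast
    ring

theorem rel_of_rayClass_eq (h : IsQuadOrder ι O D δ) {Q Q' : Forms D N}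
    (e : h.rayClass Q = h.rayClass Q') : formSetoid D N Q' Q := by
  rw [rayClass, rayClass, rayClassGroup_mk_eq_iff] at e
  obtain ⟨μ, ν, ⟨β, hβ, eμ⟩, ⟨β', hβ', eν⟩, e⟩ := exists_of_mem_principalRay e
  have eI : spanSingleton O⁰ (ν : K) * h.formIdeal Q'.2.one
      = spanSingleton O⁰ (μ : K) * h.formIdeal Q.2.one := by
    have e1 : toPrincipalIdeal O K ν * h.formUnit Q'.2.one
        = toPrincipalIdeal O K μ * h.formUnit Q.2.one := by
      rw [← e]
      change _ = (h.formUnit Q.2.one)⁻¹ * h.formUnit Q'.2.one * _ * _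
      rw [mul_right_comm, mul_right_comm _ _ (h.formUnit Q.2.one), inv_mul_cancel, one_mul, mul_comm]
    have := congrArg Units.val e1
    rwa [Units.val_mul, Units.val_mul, coe_toPrincipalIdeal, coe_toPrincipalIdeal] at this
  have hμ := μ.ne_zero
  have hν := ν.ne_zero
  have hto : ∀ z ∈ h.formIdeal Q'.2.one, ∃ m n : ℤ, ν * z = μ * (m * Q.1.root δ + n) := by
    intro z hz
    have : (ν : K) * z ∈ spanSingleton O⁰ (ν : K) * h.formIdeal Q'.2.one :=
      mem_singleton_mul.mpr ⟨z, hz, rfl⟩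
    rw [eI] at this
    obtain ⟨_, ⟨m, n, rfl⟩, h2⟩ := mem_singleton_mul.mp this
    exact ⟨m, n, h2⟩
  have hfrom : ∀ z ∈ h.formIdeal Q.2.one, ∃ m n : ℤ, μ * z = ν * (m * Q'.1.root δ + n) := by
    intro z hz
    have : (μ : K) * z ∈ spanSingleton O⁰ (μ : K) * h.formIdeal Q.2.one :=
      mem_singleton_mul.mpr ⟨z, hz, rfl⟩
    rw [← eI] at this
    obtain ⟨_, ⟨m, n, rfl⟩, h2⟩ := mem_singleton_mul.mp this
    exact ⟨m, n, h2⟩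
  obtain ⟨p, q, h1⟩ := hto _ (h.root_mem_formIdeal _)
  obtain ⟨r, s, h2⟩ := hto _ (h.one_mem_formIdeal _)
  obtain ⟨t, w, h3⟩ := hfrom _ (h.root_mem_formIdeal _)
  obtain ⟨t', w', h4⟩ := hfrom _ (h.one_mem_formIdeal _)
  obtain ⟨k1, k2⟩ := h.root_ext (Q := Q.1) Q.2.pos.ne' (m := 1) (n := 0) (m' := t * p + w * r)
    (n' := t * q + w * s) (by
      apply mul_left_cancel₀ hμ
      push_cast
      linear_combination h3 + t * h1 + w * h2)
  obtain ⟨k3, k4⟩ := h.root_ext (Q := Q.1) Q.2.pos.ne' (m := 0) (n := 1) (m' := t' * p + w' * r)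
    (n' := t' * q + w' * s) (by
      apply mul_left_cancel₀ hμ
      push_cast
      linear_combination h4 + t' * h1 + w' * h2)
  -- The integral matrices expressing each scaled basis in the other are mutually inverse, so the
  -- determinant is ±1; both zeros lie in the upper half-plane, which leaves 1.
  have hunit : (p * s - q * r) * (t * w' - w * t') = 1 := by
    linear_combination -k1 * (t' * q + w' * s) - k4 + k2 * (t' * p + w' * r)
  have hmoeb : Q'.1.root δ * (r * Q.1.root δ + s) = p * Q.1.root δ + q := by
    apply mul_left_cancel₀ hμ
    linear_combination h1 - Q'.1.root δ * h2
  have hdet : p * s - q * r = 1 := by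
    have him := Complex.im_mul_normSq_of_moebius (z := ι (Q.1.root δ)) (z' := ι (Q'.1.root δ))
      (p := p) (q := q) (r := r) (s := s) (by simpa using congrArg ι hmoeb)
    have hnn : (0 : ℝ) ≤ (p * s - q * r) * (ι (Q.1.root δ)).im := by
      rw [← him]
      exact mul_nonneg (h.root_im_pos Q'.2.one).le (Complex.normSq_nonneg _)
    have : (0 : ℝ) ≤ ((p * s - q * r : ℤ) : ℝ) := by
      push_cast
      exact nonneg_of_mul_nonneg_left hnn (h.root_im_pos Q.2.one)
    have h0 : 0 ≤ p * s - q * r := by exact_mod_cast this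
    exact Int.eq_one_or_neg_one_of_mul_eq_one hunit |>.resolve_right (by omega)
  let γ : SL(2, ℤ) := ⟨!![p, q; r, s], by rw [Matrix.det_fin_two_of]; exact hdet⟩
  have g00 : γ 0 0 = p := rfl
  have g01 : γ 0 1 = q := rfl
  have g10 : γ 1 0 = r := rfl
  have g11 : γ 1 1 = s := rfl
  refine ⟨γ, ?_, ?_⟩
  · have hz : (Q.1.a : K) * (r * Q.1.root δ + (s - 1 : ℤ)) ∈ O :=
      h.a_mul_mem Q.2.one ⟨r, s - 1, rfl⟩
    have ha : (Q.1.a : K) ∈ O := intCast_mem O _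
    -- From `ν = μ (r ω + s)` one gets `r ω + s - 1 = N (β' - β - β (r ω + s - 1))`. After
    -- multiplication by `a` the bracket lies in `O = ℤ + ℤ aω`, so `N ∣ r` and `N ∣ a (s - 1)`.
    obtain ⟨m, n, hmn⟩ := (h.mem_iff_form Q.2.one _).mp
      (sub_mem (mul_mem ha (sub_mem hβ' hβ)) (mul_mem hβ hz))
    obtain ⟨l1, l2⟩ := h.root_ext (Q := Q.1) Q.2.pos.ne' (m := Q.1.a * r) (n := Q.1.a * (s - 1))
      (m' := N * n * Q.1.a) (n' := N * m) (by
        push_cast at hmn ⊢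
        linear_combination N * hmn + Q.1.a * (eν - h2 - (r * Q.1.root δ + s) * eμ))
    have hr : (N : ℤ) ∣ r := ⟨n, mul_left_cancel₀ Q.2.pos.ne' (by linarith)⟩
    have hs : (N : ℤ) ∣ s - 1 :=
      (Int.isCoprime_iff_gcd_eq_one.mpr Q.2.coprime).symm.dvd_of_dvd_mul_left ⟨m, l2⟩
    have hr0 : (r : ZMod N) = 0 := (ZMod.intCast_zmod_eq_zero_iff_dvd _ N).mpr hr
    have hs1 : (s : ZMod N) = 1 := by
      have := (ZMod.intCast_eq_intCast_iff_dvd_sub 1 s N).mpr hs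
      simpa using this.symm
    have hd : ((p * s - q * r : ℤ) : ZMod N) = 1 := by rw [hdet]; simp
    push_cast at hd
    rw [hr0, hs1] at hd
    rw [CongruenceSubgroup.Gamma1_mem]
    exact ⟨by simpa [g00] using hd, by rw [g11]; exact hs1, by rw [g10]; exact hr0⟩
  · have hact := Q'.2.one.act_one h.neg γ
    refine h.eq_of_root_eq Q.2.one hact ?_
    have hr := h.root_act Q'.2.one γ
    rw [g00, g01, g10, g11] at hr
    have hne : (r : K) * Q'.1.root δ - p ≠ 0 := by
      intro h0
      obtain ⟨h5, h6⟩ := h.root_ext (Q := Q'.1) Q'.2.pos.ne' (m := r) (n := -p) (m' := 0) (n' := 0)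
        (by push_cast; linear_combination h0)
      have h7 : p = 0 := by omega
      simp [h5, h7] at hdet
    apply mul_left_cancel₀ hne
    linear_combination hmoeb - hr

end IsQuadOrder

end FormClassGroup

namespace FormClassGroup

open FractionalIdeal

/-! ### Forms attached to lattices -/

theorem BinForm.exists_primitive (Q : BinForm) (ha : 0 < Q.a) :
    ∃ (g : ℤ) (P : BinForm), 0 < g ∧ P.IsPrimitive ∧ 0 < P.a ∧
      Q.a = g * P.a ∧ Q.b = g * P.b ∧ Q.c = g * P.c := by
  let g : ℤ := Int.gcd Q.a (Int.gcd Q.b Q.c)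
  have hg0 : 0 < g := by
    exact Int.natCast_pos.mpr (Int.gcd_pos_of_ne_zero_left _ ha.ne')
  have h2 : g ∣ (Int.gcd Q.b Q.c : ℤ) := Int.gcd_dvd_right ..
  obtain ⟨a, ea⟩ : g ∣ Q.a := Int.gcd_dvd_left ..
  obtain ⟨b, eb⟩ : g ∣ Q.b := h2.trans (Int.gcd_dvd_left ..)
  obtain ⟨c, ec⟩ : g ∣ Q.c := h2.trans (Int.gcd_dvd_right ..)
  refine ⟨g, ⟨a, b, c⟩, hg0, ?_, ?_, ea, eb, ec⟩
  · rw [BinForm.isPrimitive_iff]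
    intro d h3 h4 h5
    have h6 : g * d ∣ g := Int.dvd_coe_gcd (ea ▸ mul_dvd_mul_left g h3)
      (Int.dvd_coe_gcd (eb ▸ mul_dvd_mul_left g h4) (ec ▸ mul_dvd_mul_left g h5))
    exact isUnit_of_dvd_one (Int.dvd_of_mul_dvd_mul_left hg0.ne' (by simpa using h6))
  · rw [ea] at ha
    exact pos_of_mul_pos_right ha hg0.le

variable {K : Type*} [Field K] {ι : K →+* ℂ} {O : Subring K} {D : ℤ} {δ : K}

theorem exists_ideal_basis (b : Module.Basis (Fin 2) ℤ O) {𝔞 : Ideal O} (h𝔞 : 𝔞 ≠ ⊥) :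
    ∃ e₀ e₁ : K, (∀ z : K, z ∈ (𝔞 : FractionalIdeal O⁰ K) ↔ ∃ m n : ℤ, z = m * e₀ + n * e₁) ∧
      ∀ m n : ℤ, (m : K) * e₀ + n * e₁ = 0 → m = 0 ∧ n = 0 := by
  let c := 𝔞.selfBasis b h𝔞
  refine ⟨((c 0 : O) : K), ((c 1 : O) : K), ?_, ?_⟩
  · intro z
    rw [FractionalIdeal.mem_coeIdeal]
    constructor
    · rintro ⟨x, hx, rfl⟩
      have h1 := c.sum_repr ⟨x, hx⟩
      rw [Fin.sum_univ_two] at h1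
      have h2 := congrArg (fun y : 𝔞 => ((y : O) : K)) h1
      simp only [Submodule.coe_add, Submodule.coe_smul_of_tower, Subring.coe_add, zsmul_eq_mul,
        Subring.coe_mul, Subring.coe_intCast] at h2
      exact ⟨_, _, h2.symm⟩
    · rintro ⟨m, n, rfl⟩
      refine ⟨m * c 0 + n * c 1, 𝔞.add_mem (𝔞.mul_mem_left _ (c 0).2) (𝔞.mul_mem_left _ (c 1).2), ?_⟩
      change (((m : O) * (c 0 : O) + n * (c 1 : O) : O) : K) = _
      push_cast
      rfl
  · intro m n hmn
    have h1 := Fintype.linearIndependent_iff.mp c.linearIndependent ![m, n] (by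
      apply Subtype.ext
      apply Subtype.ext
      simpa [Fin.sum_univ_two] using hmn)
    exact ⟨h1 0, h1 1⟩

namespace IsQuadOrder

variable [CharZero K]

theorem exists_primitive_form (h : IsQuadOrder ι O D δ) (w : K) :
    ∃ Q : BinForm, Q.IsPrimitive ∧ 0 < Q.a ∧ (Q.a : K) * w ^ 2 + Q.b * w + Q.c = 0 := by
  obtain ⟨x, y, rfl⟩ := h.exists_coord w
  -- The equation `(X - x)² = y² D` for `w = x + yδ`, cleared of denominators and divided by its
  -- content.
  obtain ⟨g, P, hg, hP, ha, e1, e2, e3⟩ := BinForm.exists_primitive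
    ⟨(x.den * y.den) ^ 2, -2 * (x.den * y.den) * (x.num * y.den),
      (x.num * y.den) ^ 2 - (y.num * x.den) ^ 2 * D⟩ (by
        have := x.den_pos
        have := y.den_pos
        positivity)
  refine ⟨P, hP, ha, ?_⟩
  have e1' := congrArg (Int.cast (R := K)) e1
  have e2' := congrArg (Int.cast (R := K)) e2
  have e3' := congrArg (Int.cast (R := K)) e3
  push_cast at e1' e2' e3'
  have hg' : (g : K) ≠ 0 := by exact_mod_cast hg.ne'
  have h1 : (x.den : K) ≠ 0 := by exact_mod_cast x.den_ne_zero
  have h2 : (y.den : K) ≠ 0 := by exact_mod_cast y.den_ne_zero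
  have hx : (x.den : K) * x = x.num := by exact_mod_cast Rat.den_mul_eq_num x
  have hy : (y.den : K) * y = y.num := by exact_mod_cast Rat.den_mul_eq_num y
  apply mul_left_cancel₀ hg'
  have e : (x.den * y.den : K) * (x + y * δ) = x.num * y.den + y.num * x.den * δ := by
    linear_combination (y.den : K) * hx + x.den * δ * hy
  linear_combination -(x + y * δ : K) ^ 2 * e1' - (x + y * δ : K) * e2' - e3' +
    ((x.den * y.den : K) * (x + y * δ) - x.num * y.den + y.num * x.den * δ) * e +
    (y.num * x.den : K) ^ 2 * h.sq

theorem coord_ext_of_im_pos {w : K} (hw : 0 < (ι w).im) {m n m' n' : ℤ}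
    (e : (m : K) * w + n = m' * w + n') : m = m' ∧ n = n' := by
  have h1 := congrArg (fun z => (ι z).im) e
  simp at h1
  have h2 : m = m' := h1.resolve_right hw.ne'
  subst h2
  exact ⟨rfl, by exact_mod_cast add_left_cancel e⟩

/-- If `O` is the multiplier ring of `[w, 1]`, then the primitive form with the zero `w` has the
discriminant of `O`. -/
theorem isFormOf_of_multiplier (h : IsQuadOrder ι O D δ) {w : K} (hw : 0 < (ι w).im)
    {Q : BinForm} (hQ : Q.IsPrimitive) (ha : 0 < Q.a)
    (e : (Q.a : K) * w ^ 2 + Q.b * w + Q.c = 0)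
    (hO : ∀ z : K, z ∈ O ↔ (∃ m n : ℤ, z * w = m * w + n) ∧ ∃ m n : ℤ, z = m * w + n) :
    IsFormOf D 1 Q ∧ Q.root δ = w := by
  have ha0 : (Q.a : K) ≠ 0 := by exact_mod_cast ha.ne'
  have haw : (Q.a : K) * w ∈ O := (hO _).mpr
    ⟨⟨-Q.b, -Q.c, by push_cast; linear_combination e⟩, ⟨Q.a, 0, by simp⟩⟩
  have hτ : ((D : K) + δ) / 2 ∈ O := (h.mem_iff _).mpr ⟨0, 1, by simp⟩
  obtain ⟨m, n, hmn⟩ := (h.mem_iff _).mp haw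
  obtain ⟨⟨x, y, hxy⟩, k, l, hkl⟩ := (hO _).mp hτ
  -- Since `k w + l` maps `w` into `[w, 1]`, the leading coefficient divides `k b` and `k c`; by
  -- primitivity it divides `k`.
  obtain ⟨k', hk'⟩ : Q.a ∣ k := by
    obtain ⟨h1, h2⟩ := coord_ext_of_im_pos hw (m := Q.a * l - Q.b * k) (n := -Q.c * k)
      (m' := Q.a * x) (n' := Q.a * y) (by
        push_cast
        rw [hkl] at hxy
        linear_combination Q.a * hxy - k * e)
    obtain ⟨p, q, r, hpqr⟩ := BinForm.exists_bezout_of_gcd_eq_one hQ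
    refine ⟨p * k + q * (l - x) - r * y, ?_⟩
    linear_combination -k * hpqr - q * h1 - r * h2
  have hk'' : (k : K) = Q.a * k' := by exact_mod_cast hk'
  have hnk : n * k' = 1 := by
    obtain ⟨h1, -⟩ := coord_ext_of_im_pos hw (m := Q.a) (n := 0) (m' := Q.a * (n * k'))
      (n' := m + n * l) (by
        push_cast
        rw [hkl, hk''] at hmn
        linear_combination hmn)
    exact mul_left_cancel₀ ha.ne' (by linarith)
  have hn : n = 1 ∨ n = -1 := Int.eq_one_or_neg_one_of_mul_eq_one hnk
  have hn2 : n ^ 2 = 1 := by rcases hn with rfl | rfl <;> norm_num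
  have hn2' : (n : K) ^ 2 = 1 := by exact_mod_cast hn2
  have h2 : 2 * (Q.a : K) * w + Q.b = (2 * m + Q.b + n * D) + n * δ := by
    linear_combination 2 * hmn
  -- The square of `2aw + b` is the rational number `b² - 4ac`. The `δ`-coordinate forces the
  -- rational part of `2aw + b` to vanish, and the discriminant is then `n² D = D`.
  obtain ⟨h3, h4⟩ := h.coord_ext (x := (2 * m + Q.b + n * D) ^ 2 + D)
    (y := 2 * (2 * m + Q.b + n * D) * n) (x' := Q.b ^ 2 - 4 * Q.a * Q.c) (y' := 0) (by
      push_cast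
      linear_combination (4 * Q.a : K) * e - (2 * (Q.a : K) * w + Q.b + (2 * m + Q.b + n * D) + n * δ)
        * h2 - (n : K) ^ 2 * h.sq - D * hn2')
  have h5 : 2 * m + Q.b + n * D = 0 := by
    have : 2 * (2 * m + Q.b + n * D) * n = 0 := by exact_mod_cast h4
    rcases hn with rfl | rfl <;> omega
  have h5' : (2 * m + Q.b + n * D : K) = 0 := by exact_mod_cast h5
  have hdisc : Q.disc = D := by
    have h6 : (2 * m + Q.b + n * D) ^ 2 + D = Q.b ^ 2 - 4 * Q.a * Q.c := by exact_mod_cast h3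
    rw [h5] at h6
    unfold BinForm.disc
    linarith
  have hform : IsFormOf D 1 Q := ⟨hQ, hdisc, ha, by simp⟩
  refine ⟨hform, ?_⟩
  rw [h5', zero_add] at h2
  have hn1 : n = 1 := by
    have h7 := congrArg (fun z => (ι z).im) h2
    simp only [map_add, map_mul, map_intCast, map_ofNat, h.map_sqrt] at h7
    simp at h7
    have h8 : (0 : ℝ) < 2 * Q.a * (ι w).im := by
      have : (0 : ℝ) < Q.a := by exact_mod_cast ha
      positivity
    rw [h7] at h8
    have h9 := pos_of_mul_pos_left h8 (Real.sqrt_nonneg _)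
    have : 0 < n := by exact_mod_cast h9
    omega
  have h10 := a_mul_root (K := K) (δ := δ) ha.ne'
  apply mul_left_cancel₀ (mul_ne_zero two_ne_zero ha0)
  rw [hn1] at h2
  push_cast at h2
  linear_combination h10 - h2

/-- If `ν ≡ 1` modulo `N` and `ν [ω_Q, 1]` is integral, then `a` is prime to `N`. -/
theorem gcd_eq_one_of_mul_mem (h : IsQuadOrder ι O D δ) {N : ℕ} {Q : BinForm}
    (hQ : IsFormOf D 1 Q) {ν : K} (hν : ∃ β ∈ O, ν = 1 + N * β) (hω : ν * Q.root δ ∈ O) :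
    Int.gcd Q.a N = 1 := by
  obtain ⟨β, hβ, rfl⟩ := hν
  obtain ⟨x, y, rfl⟩ := (h.mem_iff_form hQ β).mp hβ
  obtain ⟨m, n, hmn⟩ := (h.mem_iff_form hQ _).mp hω
  -- The `ω`-coordinate of `ν ω` is `1 + N (x - y b)`; integrality makes it a multiple of `a`.
  obtain ⟨h1, -⟩ := h.root_ext hQ.pos.ne' (m := 1 + N * x - N * y * Q.b) (n := -N * y * Q.c)
    (m' := n * Q.a) (n' := m) (by
      push_cast
      linear_combination hmn - (N * y : K) * h.root_quadratic hQ)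
  exact Int.isCoprime_iff_gcd_eq_one.mp ⟨n, y * Q.b - x, by linear_combination -h1⟩

variable [IsFractionRing O K]

/-- Every ideal prime to `N` is a ray multiple of the lattice of a form. -/
theorem exists_rayClass_eq (h : IsQuadOrder ι O D δ) {N : ℕ} (hN : 0 < N) (I : idealsPrimeTo O N)
    {𝔞 : Ideal O} (h𝔞 : 𝔞 ≠ ⊥) (hco : 𝔞 ⊔ Ideal.span {(N : O)} = ⊤)
    (hI : (I.1 : FractionalIdeal O⁰ K) = (𝔞 : FractionalIdeal O⁰ K)) :
    ∃ Q : Forms D N, h.rayClass Q = QuotientGroup.mk I := by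
  obtain ⟨b⟩ := h.basis
  obtain ⟨e₀, e₁, he, hind⟩ := exists_ideal_basis b h𝔞
  obtain ⟨ν₀, hν₀, t, ht, hνt⟩ := Submodule.mem_sup.mp ((Ideal.eq_top_iff_one _).mp hco)
  obtain ⟨t, rfl⟩ := Ideal.mem_span_singleton.mp ht
  obtain ⟨x, y, hxy⟩ := (he ν₀).mp ((mem_coeIdeal _).mpr ⟨ν₀, hν₀, rfl⟩)
  have hone : (ν₀ : K) + N * t = 1 := by exact_mod_cast congrArg Subtype.val hνt
  have hle : ∀ z ∈ (𝔞 : FractionalIdeal O⁰ K), z ∈ O := by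
    rintro _ hz
    obtain ⟨z, -, rfl⟩ := (mem_coeIdeal _).mp hz
    exact z.2
  have he₀ : e₀ ∈ (𝔞 : FractionalIdeal O⁰ K) := (he _).mpr ⟨1, 0, by simp⟩
  have he₁ : e₁ ∈ (𝔞 : FractionalIdeal O⁰ K) := (he _).mpr ⟨0, 1, by simp⟩
  -- A prime dividing `x`, `y` and `N` would divide `1 = ν₀ + N t` in `O`.
  obtain ⟨σ, hσ⟩ : ∃ σ : SL(2, ℤ), BottomRow N σ x y := by
    apply exists_bottomRow hN
    rintro p hp ⟨x', rfl⟩ ⟨y', rfl⟩ ⟨n, hn⟩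
    have hn' : (N : K) = p * n := by exact_mod_cast hn
    have hz : (x' : K) * e₀ + y' * e₁ + n * t ∈ O :=
      add_mem (hle _ ((he _).mpr ⟨x', y', rfl⟩)) (mul_mem (intCast_mem O _) t.2)
    obtain ⟨k, l, hkl⟩ := (h.mem_iff _).mp hz
    have h1 : (1 : K) = p * (k + l * ((D + δ) / 2)) := by
      rw [← hkl, ← hone, hxy, hn']
      push_cast
      ring
    obtain ⟨h2, h3⟩ := h.coord_ext (x := 1) (y := 0) (x' := p * (k + l * (D / 2)))
      (y' := p * (l / 2)) (by push_cast; linear_combination h1)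
    have h4 : (p : ℚ) ≠ 0 := by exact_mod_cast hp.ne_zero
    have h5 : (l : ℚ) = 0 := by
      rcases mul_eq_zero.mp h3.symm with h | h
      · exact absurd h h4
      · linarith
    rw [h5] at h2
    have h6 : 1 = p * k := by
      have : (1 : ℚ) = p * k := by linarith
      exact_mod_cast this
    exact hp.not_isUnit (IsUnit.of_mul_eq_one _ h6.symm)
  have hdet := det_eq_one σ
  have hdet' : (σ 0 0 : K) * σ 1 1 - σ 0 1 * σ 1 0 = 1 := by exact_mod_cast hdet
  set p := σ 0 0
  set q := σ 0 1
  set r := σ 1 0 with hr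
  set s := σ 1 1 with hs
  -- The rows of `σ` give a new basis `e', ν` of the ideal, with `ν` congruent to `ν₀`, hence to 1,
  -- modulo `N O`.
  set ν : K := r * e₀ + s * e₁ with hν
  set e' : K := p * e₀ + q * e₁ with he'
  have hν0 : ν ≠ 0 := by
    intro h0
    obtain ⟨h1, h2⟩ := hind _ _ h0
    simp [h1, h2] at hdet
  have hνI : ν ∈ (𝔞 : FractionalIdeal O⁰ K) := (he _).mpr ⟨r, s, rfl⟩
  have hray : ∃ β ∈ O, ν = 1 + N * β := by
    obtain ⟨r', hr'⟩ := Int.modEq_iff_dvd.mp hσ.1.symm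
    obtain ⟨s', hs'⟩ := Int.modEq_iff_dvd.mp hσ.2.symm
    have hr'' : (r : K) - x = N * r' := by exact_mod_cast hr'
    have hs'' : (s : K) - y = N * s' := by exact_mod_cast hs'
    refine ⟨r' * e₀ + s' * e₁ - t, sub_mem (hle _ ((he _).mpr ⟨r', s', rfl⟩)) t.2, ?_⟩
    linear_combination e₀ * hr'' + e₁ * hs'' + hone - hxy
  have him0 : (ι (e' / ν)).im ≠ 0 := by
    obtain ⟨x₀, y₀, hxy₀⟩ := h.exists_coord (e' / ν)
    rw [hxy₀, h.im_coord]
    refine mul_ne_zero ?_ h.sqrt_pos.ne'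
    intro hy0
    have hy0' : y₀ = 0 := by exact_mod_cast hy0
    rw [hy0'] at hxy₀
    have hden : (x₀.den : K) * x₀ = x₀.num := by exact_mod_cast Rat.den_mul_eq_num x₀
    have h1 : e' = x₀ * ν := by
      rw [div_eq_iff hν0] at hxy₀
      rw [hxy₀]
      simp
    obtain ⟨h2, h3⟩ := hind (x₀.den * p - x₀.num * r) (x₀.den * q - x₀.num * s) (by
      push_cast
      linear_combination (x₀.den : K) * h1 + ν * hden)
    have h4 : (x₀.den : ℤ) = 0 := by
      linear_combination -(x₀.den : ℤ) * hdet + s * h2 - r * h3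
    exact x₀.den_ne_zero (by exact_mod_cast h4)
  -- A sign puts `w = ±e'/ν` in the upper half-plane without changing the lattice `[w, 1]`.
  obtain ⟨ε, hε, hpos⟩ : ∃ ε : ℤ, ε * ε = 1 ∧ 0 < (ι (ε * (e' / ν))).im := by
    rcases lt_or_gt_of_ne him0 with h1 | h1
    · exact ⟨-1, by norm_num, by simpa using h1⟩
    · exact ⟨1, by norm_num, by simpa using h1⟩
  have hε' : (ε : K) * ε = 1 := by exact_mod_cast hε
  set w : K := ε * (e' / ν) with hw
  have hνw : ν * w = ε * e' := by
    rw [hw]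
    field_simp
  have hlat : ∀ z : K, ν * z ∈ (𝔞 : FractionalIdeal O⁰ K) ↔ ∃ m n : ℤ, z = m * w + n := by
    intro z
    rw [he]
    constructor
    · rintro ⟨m, n, hmn⟩
      refine ⟨ε * (m * s - n * r), n * p - m * q, mul_left_cancel₀ hν0 ?_⟩
      push_cast
      linear_combination hmn - ε * (m * s - n * r) * hνw - (m * e₀ + n * e₁) * hdet'
        - (m * s - n * r) * e' * hε'
    · rintro ⟨m, n, rfl⟩
      refine ⟨m * ε * p + n * r, m * ε * q + n * s, ?_⟩
      push_cast
      linear_combination (m : K) * hνw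
  -- The ideal is invertible, so its multiplier ring, which is that of `[w, 1]`, is exactly `O`.
  have hmul : ∀ z : K, z ∈ O ↔ (∃ m n : ℤ, z * w = m * w + n) ∧ ∃ m n : ℤ, z = m * w + n := by
    intro z
    rw [← hlat, ← hlat]
    have hwI : ν * w ∈ (𝔞 : FractionalIdeal O⁰ K) := (hlat w).mpr ⟨1, 0, by simp⟩
    constructor
    · intro hz
      have hsm : ∀ u ∈ (𝔞 : FractionalIdeal O⁰ K), z * u ∈ (𝔞 : FractionalIdeal O⁰ K) :=
        fun u hu => (𝔞 : FractionalIdeal O⁰ K).coeToSubmodule.smul_mem (⟨z, hz⟩ : O) hu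
      refine ⟨?_, ?_⟩
      · rw [mul_left_comm]
        exact hsm _ hwI
      · rw [mul_comm]
        exact hsm _ hνI
    · rintro ⟨h1, h2⟩
      apply mem_of_mul_mem_unit I.1
      rw [hI]
      intro u hu
      have hu' : ν * (u / ν) ∈ (𝔞 : FractionalIdeal O⁰ K) := by rwa [mul_div_cancel₀ _ hν0]
      obtain ⟨m, n, hmn⟩ := (hlat _).mp hu'
      have hu2 : z * u = m * (ν * (z * w)) + n * (ν * z) := by
        rw [div_eq_iff hν0] at hmn
        rw [hmn]
        ring
      rw [hu2]
      exact mul_add_mul_mem h1 h2 m n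
  obtain ⟨Q, hprim, ha, hroot⟩ := h.exists_primitive_form w
  obtain ⟨hQ, hQw⟩ := h.isFormOf_of_multiplier hpos hprim ha hroot hmul
  have hgcd : Int.gcd Q.a N = 1 := h.gcd_eq_one_of_mul_mem hQ hray (by
    rw [hQw]
    exact hle _ ((hlat w).mpr ⟨1, 0, by simp⟩))
  refine ⟨⟨Q, hQ.primitive, hQ.disc_eq, hQ.pos, hgcd⟩, ?_⟩
  have hI' : I.1 = toPrincipalIdeal O K (Units.mk0 ν hν0) * h.formUnit hQ := by
    ext1
    rw [hI, Units.val_mul, coe_toPrincipalIdeal, coe_formUnit]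
    ext z
    rw [mem_singleton_mul]
    simp only [mem_formIdeal, hQw, ← hlat, Units.val_mk0]
    constructor
    · intro hz
      exact ⟨z / ν, by rwa [mul_div_cancel₀ _ hν0], by rw [mul_div_cancel₀ _ hν0]⟩
    · rintro ⟨u, hu, rfl⟩
      exact hu
  rw [rayClass, rayClassGroup_mk_eq_iff, hI']
  change (h.formUnit hQ)⁻¹ * _ ∈ _
  rw [mul_left_comm, inv_mul_cancel, mul_one]
  exact principal_mem_principalRay (hle _ hνI) hray

end IsQuadOrder

end FormClassGroup

namespace FormClassGroup

/-! ### Orders in imaginary quadratic fields -/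

section RankTwo

variable {R : Type*} [CommRing R]

/-- In a ring of rank two over `ℤ`, the unit element is part of a basis. -/
theorem exists_basis_one (b : Module.Basis (Fin 2) ℤ R) :
    ∃ c : Module.Basis (Fin 2) ℤ R, c 0 = 1 := by
  have : Module.Finite ℤ R := Module.Finite.of_basis b
  have : Module.Free ℤ R := Module.Free.of_basis b
  set x := b.repr 1 0 with hx
  set y := b.repr 1 1 with hy
  have hxy : x • b 0 + y • b 1 = 1 := by
    rw [← b.sum_repr 1, Fin.sum_univ_two]
  have hco : IsCoprime x y := by
    rw [Int.isCoprime_iff_gcd_eq_one]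
    obtain ⟨x', hx'⟩ : (Int.gcd x y : ℤ) ∣ x := Int.gcd_dvd_left ..
    obtain ⟨y', hy'⟩ : (Int.gcd x y : ℤ) ∣ y := Int.gcd_dvd_right ..
    have h1 : (1 : R) = algebraMap ℤ R (Int.gcd x y) * (x' • b 0 + y' • b 1) := by
      rw [← Algebra.smul_def, smul_add, ← mul_smul, ← mul_smul, ← hx', ← hy', hxy]
    -- An integer `g` dividing 1 in a ring of rank two has unit norm `g²`.
    have h2 := congrArg (Algebra.norm ℤ) h1
    rw [map_one, map_mul, Algebra.norm_algebraMap_of_basis b] at h2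
    have h3 := IsUnit.of_mul_eq_one _ h2.symm
    rw [Fintype.card_fin, isUnit_pow_iff two_ne_zero, Int.isUnit_iff] at h3
    omega
  obtain ⟨u, v, huv⟩ := hco
  -- By the Bézout relation, `(-v, u)` completes the coordinates of 1 to a matrix of determinant 1.
  let τ : R := -v • b 0 + u • b 1
  have hli : LinearIndependent ℤ ![(1 : R), τ] := by
    rw [LinearIndependent.pair_iff]
    intro s t hst
    have h1 : (s * x - t * v) • b 0 + (s * y + t * u) • b 1 = 0 := by
      rw [← hst, ← hxy]
      module
    have h2 := Fintype.linearIndependent_iff.mp b.linearIndependent ![s * x - t * v, s * y + t * u]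
      (by simpa [Fin.sum_univ_two] using h1)
    have h3 : s * x - t * v = 0 := h2 0
    have h4 : s * y + t * u = 0 := h2 1
    exact ⟨by linear_combination u * h3 + v * h4 - s * huv,
      by linear_combination x * h4 - y * h3 - t * huv⟩
  have hsp : ⊤ ≤ Submodule.span ℤ (Set.range ![(1 : R), τ]) := by
    rw [← b.span_eq, Submodule.span_le]
    rintro _ ⟨i, rfl⟩
    have m0 : (1 : R) ∈ Submodule.span ℤ (Set.range ![(1 : R), τ]) :=
      Submodule.subset_span ⟨0, rfl⟩
    have m1 : τ ∈ Submodule.span ℤ (Set.range ![(1 : R), τ]) :=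
      Submodule.subset_span ⟨1, rfl⟩
    have e0 : b 0 = u • 1 + (-y) • τ := by
      rw [← hxy]
      simp only [τ]
      have : b 0 = (u * x + v * y) • b 0 := by rw [huv, one_smul]
      exact this.trans (by module)
    have e1 : b 1 = v • 1 + x • τ := by
      rw [← hxy]
      simp only [τ]
      have : b 1 = (u * x + v * y) • b 1 := by rw [huv, one_smul]
      exact this.trans (by module)
    fin_cases i
    · change b 0 ∈ _
      rw [e0]
      exact add_mem (Submodule.smul_mem _ _ m0) (Submodule.smul_mem _ _ m1)
    · change b 1 ∈ _
      rw [e1]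
      exact add_mem (Submodule.smul_mem _ _ m0) (Submodule.smul_mem _ _ m1)
  exact ⟨Module.Basis.mk hli hsp, by simp⟩

/-- If `τ² = n + tτ`, then `τ` has trace `t`, and the trace form on `1, τ` has determinant `2 (t² +
2n) - t²`. -/
theorem discr_basis_one (c : Module.Basis (Fin 2) ℤ R) (h : c 0 = 1) :
    Algebra.discr ℤ c = c.repr (c 1 * c 1) 1 ^ 2 + 4 * c.repr (c 1 * c 1) 0 := by
  have : Module.Finite ℤ R := Module.Finite.of_basis c
  have : Module.Free ℤ R := Module.Free.of_basis c
  set t := c.repr (c 1 * c 1) 1 with ht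
  set n := c.repr (c 1 * c 1) 0 with hn
  have hsq : c 1 * c 1 = n • 1 + t • c 1 := by
    rw [← h, ← c.sum_repr (c 1 * c 1), Fin.sum_univ_two]
  have htr1 : Algebra.trace ℤ R 1 = 2 := by
    rw [← map_one (algebraMap ℤ R), Algebra.trace_algebraMap_of_basis c]
    simp
  have htr : Algebra.trace ℤ R (c 1) = t := by
    rw [Algebra.trace_eq_matrix_trace c, Matrix.trace_fin_two, Algebra.leftMulMatrix_eq_repr_mul,
      Algebra.leftMulMatrix_eq_repr_mul, h, mul_one, ← ht]
    simp
  rw [Algebra.discr_def, Matrix.det_fin_two]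
  simp only [Algebra.traceMatrix_apply, Algebra.traceForm_apply, h, mul_one, one_mul, hsq, map_add,
    map_smul, htr1, htr, smul_eq_mul]
  ring

end RankTwo

variable {K : Type*} [Field K]

theorem IsOrder.exists_basis [CharZero K] (hK : Module.finrank ℚ K = 2) {O : Subring K}
    (hO : IsOrder O) : ∃ c : Module.Basis (Fin 2) ℤ O, c 0 = 1 ∧
      orderDiscr O = Algebra.discr ℤ c := by
  have := hO.finite
  let c := Module.Free.chooseBasis ℤ O
  have hli : LinearIndependent ℤ (fun i => (c i : K)) :=
    c.linearIndependent.map' (O.subtype.toAddMonoidHom.toIntLinearMap)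
      (LinearMap.ker_eq_bot.mpr Subtype.val_injective)
  rw [LinearIndependent.iff_fractionRing ℤ ℚ] at hli
  have hsp : ⊤ ≤ Submodule.span ℚ (Set.range fun i => (c i : K)) := by
    rw [← hO.span_eq_top, Submodule.span_le]
    intro z hz
    have h1 := congrArg (Subtype.val) (c.sum_repr ⟨z, hz⟩)
    replace h1 : ((∑ i, c.repr ⟨z, hz⟩ i • c i : O) : K) = z := h1
    rw [SetLike.mem_coe, ← h1]
    simp only [AddSubmonoidClass.coe_finsetSum]
    refine Submodule.sum_mem _ fun i _ => ?_
    rw [zsmul_eq_mul, Subring.coe_mul, Subring.coe_intCast,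
      show ((c.repr ⟨z, hz⟩ i : ℤ) : K) * (c i : K) = ((c.repr ⟨z, hz⟩ i : ℤ) : ℚ) • (c i : K) by
        rw [Algebra.smul_def]; simp]
    exact Submodule.smul_mem _ _ (Submodule.subset_span ⟨i, rfl⟩)
  have hcard : Fintype.card (Module.Free.ChooseBasisIndex ℤ O) = 2 := by
    rw [← hK, Module.finrank_eq_card_basis (Module.Basis.mk hli hsp)]
  let e := Fintype.equivFinOfCardEq hcard
  obtain ⟨c', hc'⟩ := exists_basis_one (c.reindex e)
  refine ⟨c', hc', ?_⟩
  rw [Algebra.discr_eq_discr O c' (c.reindex e), Module.Basis.coe_reindex, Algebra.discr_reindex]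
  simp only [orderDiscr, dif_pos this]
  congr!

/-- For a basis `1, T` with `T² = n + tT`, the number `2T - t` squares to `D`. Were its image in `ℂ`
real, `ι` would be a real embedding; so `D < 0`, and `δ` is `2T - t` up to the sign that puts it in
the upper half-plane. -/
theorem IsOrder.exists_isQuadOrder [NumberField K] [NumberField.IsTotallyComplex K]
    (hK : Module.finrank ℚ K = 2) (ι : K →+* ℂ) {O : Subring K} (hO : IsOrder O) :
    ∃ δ : K, IsQuadOrder ι O (orderDiscr O) δ := by
  obtain ⟨c, hc, hD⟩ := hO.exists_basis hK
  rw [discr_basis_one c hc] at hD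
  set t := c.repr (c 1 * c 1) 1 with ht
  set n := c.repr (c 1 * c 1) 0 with hn
  set D := orderDiscr O
  set T : K := (c 1 : K) with hT
  have hsq : T * T = n + t * T := by
    have h1 : c 1 * c 1 = n • 1 + t • c 1 := by
      rw [← hc, ← c.sum_repr (c 1 * c 1), Fin.sum_univ_two]
    have h2 := congrArg (Subtype.val) h1
    simpa using h2
  have hD' : (D : K) = t ^ 2 + 4 * n := by exact_mod_cast hD
  have hmem : ∀ z : K, z ∈ O ↔ ∃ m n : ℤ, z = m + n * T := by
    intro z
    constructor
    · intro hz
      have h1 := c.sum_repr ⟨z, hz⟩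
      rw [Fin.sum_univ_two, hc] at h1
      have h2 := congrArg (Subtype.val) h1
      exact ⟨_, _, by simpa using h2.symm⟩
    · rintro ⟨m, n, rfl⟩
      exact add_mem (intCast_mem O _) (mul_mem (intCast_mem O _) (c 1).2)
  have hspan : ∀ z : K, ∃ x y : ℚ, z = x + y * (2 * T - t) := by
    intro z
    have hz : z ∈ Submodule.span ℚ (O : Set K) := by rw [hO.span_eq_top]; trivial
    induction hz using Submodule.span_induction with
    | mem z hz =>
      obtain ⟨m, n, rfl⟩ := (hmem z).mp hz
      exact ⟨m + n * t / 2, n / 2, by push_cast; ring⟩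
    | zero => exact ⟨0, 0, by simp⟩
    | add x y _ _ hx hy =>
      obtain ⟨x, y, rfl⟩ := hx
      obtain ⟨x', y', rfl⟩ := hy
      exact ⟨x + x', y + y', by push_cast; ring⟩
    | smul a x _ hx =>
      obtain ⟨x, y, rfl⟩ := hx
      exact ⟨a * x, a * y, by rw [Algebra.smul_def]; push_cast; simp; ring⟩
  have hδsq : (2 * T - t) ^ 2 = (D : K) := by
    rw [hD']
    linear_combination 4 * hsq
  set w : ℂ := ι (2 * T - t) with hw
  have hwsq : w ^ 2 = ((D : ℝ) : ℂ) := by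
    rw [hw, ← map_pow, hδsq]
    simp
  have hre := congrArg Complex.re hwsq
  have him := congrArg Complex.im hwsq
  rw [pow_two, Complex.mul_re, Complex.ofReal_re] at hre
  rw [pow_two, Complex.mul_im, Complex.ofReal_im] at him
  have him' : w.re * w.im = 0 := by linarith
  have hnotreal : w.im ≠ 0 := by
    intro h0
    have h1 := NumberField.IsTotallyComplex.isComplex (NumberField.InfinitePlace.mk ι)
    rw [NumberField.InfinitePlace.isComplex_mk_iff] at h1
    apply h1
    rw [NumberField.ComplexEmbedding.isReal_iff]
    ext z
    obtain ⟨x, y, rfl⟩ := hspan z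
    rw [NumberField.ComplexEmbedding.conjugate_coe_eq, Complex.conj_eq_iff_im, map_add, map_mul,
      ← hw, map_ratCast, map_ratCast]
    simp [h0]
  have hre0 : w.re = 0 := (mul_eq_zero.mp him').resolve_right hnotreal
  rw [hre0] at hre
  have hneg : D < 0 := by
    have : (D : ℝ) < 0 := by
      have : 0 < w.im * w.im := mul_self_pos.mpr hnotreal
      linarith
    exact_mod_cast this
  have hsqrt : Real.sqrt (-(D : ℝ)) = |w.im| := by
    rw [← hre, ← Real.sqrt_sq_eq_abs]
    congr 1
    ring
  obtain ⟨k, hk⟩ : (2 : ℤ) ∣ D - t := by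
    rw [hD, show t ^ 2 + 4 * n - t = t * (t - 1) + 2 * (2 * n) by ring]
    exact dvd_add (Int.even_mul_pred_self t).two_dvd (dvd_mul_right _ _)
  have hk' : (D : K) - t = 2 * k := by exact_mod_cast hk
  have hwI : w = (w.im : ℂ) * Complex.I := by
    apply Complex.ext <;> simp [hre0]
  rcases lt_or_gt_of_ne hnotreal with hlt | hgt
  · refine ⟨-(2 * T - t), hneg, ?_, ?_, ?_, ⟨c⟩⟩
    · rw [map_neg, ← hw, hsqrt, abs_of_neg hlt, hwI]
      simp
    · intro z
      have e : ((D : K) + -(2 * T - t)) / 2 = -T + (k + t) := by linear_combination hk' / 2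
      rw [hmem, e]
      constructor
      · rintro ⟨m, n, rfl⟩
        exact ⟨m + n * (k + t), -n, by push_cast; ring⟩
      · rintro ⟨m, n, rfl⟩
        exact ⟨m + n * (k + t), -n, by push_cast; ring⟩
    · intro z
      obtain ⟨x, y, rfl⟩ := hspan z
      exact ⟨x, -y, by push_cast; ring⟩
  · refine ⟨2 * T - t, hneg, ?_, ?_, hspan, ⟨c⟩⟩
    · rw [← hw, hsqrt, abs_of_pos hgt, ← hwI]
    · intro z
      have e : ((D : K) + (2 * T - t)) / 2 = T + k := by linear_combination hk' / 2
      rw [hmem, e]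
      constructor
      · rintro ⟨m, n, rfl⟩
        exact ⟨m - n * k, n, by push_cast; ring⟩
      · rintro ⟨m, n, rfl⟩
        exact ⟨m + n * k, n, by push_cast; ring⟩

end FormClassGroup

namespace FormClassGroup

/-! ### The isomorphism -/

/-- This supplies inverses in the image of the form classes without constructing inverse forms at
level `N`. -/
theorem _root_.Submonoid.inv_mem_of_finite {G : Type*} [Group G] (S : Submonoid G)
    (hS : (S : Set G).Finite) {x : G} (hx : x ∈ S) : x⁻¹ ∈ S := by
  have h1 : IsOfFinOrder x := finite_powers.mp (hS.subset (Submonoid.powers_le.mpr hx))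
  have h2 : x⁻¹ ∈ Submonoid.powers x :=
    h1.mem_powers_iff_mem_zpowers.mpr (inv_mem (Subgroup.mem_zpowers x))
  exact Submonoid.powers_le.mpr hx h2

namespace IsQuadOrder

variable {K : Type*} [Field K] [CharZero K] {ι : K →+* ℂ} {O : Subring K} {D : ℤ} {δ : K} {N : ℕ}

/-- The form to be transported takes a value prime to `N` at `(v, -u)`. -/
theorem gcd_eval_eq_one (h : IsQuadOrder ι O D δ) {Q Q' : Forms D N} {γ : SL(2, ℤ)}
    {B u v : ℤ} (hB : IsDirichletMiddle D Q.1 (Q'.1.act γ) B)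
    (huv : IsUnitRelation γ (Q'.1.act γ) (dirichletComp D Q.1 (Q'.1.act γ) B) u v) :
    Int.gcd ((dirichletComp D Q.1 (Q'.1.act γ) B).eval v (-u)) N = 1 := by
  have hQ'' := Q'.2.one.act_one h.neg γ
  obtain ⟨X, Y, hX, hY, -, hcY, -⟩ :=
    hB.exists_eq Q.2.disc_eq hQ''.disc_eq Q.2.pos.ne' hQ''.pos.ne'
  obtain ⟨rfl, rfl⟩ := (h.isUnitRelation_iff Q.2.one hQ'' hB hY u v).mp huv
  rw [IsDirichletMiddle.eval_eq hY hcY, ← Int.isCoprime_iff_gcd_eq_one]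
  exact (Int.isCoprime_iff_gcd_eq_one.mpr Q.2.coprime).mul_left
    (Int.isCoprime_iff_gcd_eq_one.mpr Q'.2.coprime)

theorem exists_bottomRow (h : IsQuadOrder ι O D δ) (hN : 0 < N) {Q Q' : Forms D N} {γ : SL(2, ℤ)}
    {B u v : ℤ} (hB : IsDirichletMiddle D Q.1 (Q'.1.act γ) B)
    (huv : IsUnitRelation γ (Q'.1.act γ) (dirichletComp D Q.1 (Q'.1.act γ) B) u v) :
    ∃ σ : SL(2, ℤ), BottomRow N σ u v := by
  apply FormClassGroup.exists_bottomRow hN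
  intro p hp hu hv hpN
  have h1 := h.gcd_eval_eq_one hB huv
  have h2 : p ∣ (dirichletComp D Q.1 (Q'.1.act γ) B).eval v (-u) := by
    unfold BinForm.eval
    exact dvd_add (dvd_add ((hv.pow two_ne_zero).mul_left _) ((hv.mul_left _).mul_right _))
      (((dvd_neg.mpr hu).pow two_ne_zero).mul_left _)
  have h3 := Int.dvd_coe_gcd h2 hpN
  rw [h1] at h3
  exact hp.not_isUnit (isUnit_of_dvd_one h3)

theorem exists_isUnitRelation (h : IsQuadOrder ι O D δ) {Q Q' : Forms D N} {γ : SL(2, ℤ)} {B : ℤ}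
    (hB : IsDirichletMiddle D Q.1 (Q'.1.act γ) B) :
    ∃ u v, IsUnitRelation γ (Q'.1.act γ) (dirichletComp D Q.1 (Q'.1.act γ) B) u v := by
  have hQ'' := Q'.2.one.act_one h.neg γ
  obtain ⟨X, Y, -, hY, -, -, -⟩ :=
    hB.exists_eq Q.2.disc_eq hQ''.disc_eq Q.2.pos.ne' hQ''.pos.ne'
  exact ⟨_, _, (h.isUnitRelation_iff Q.2.one hQ'' hB hY _ _).mpr ⟨rfl, rfl⟩⟩

theorem isFormOf_composite (h : IsQuadOrder ι O D δ) {Q Q' : Forms D N} {γ σ : SL(2, ℤ)}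
    {B u v : ℤ} (hB : IsDirichletMiddle D Q.1 (Q'.1.act γ) B)
    (huv : IsUnitRelation γ (Q'.1.act γ) (dirichletComp D Q.1 (Q'.1.act γ) B) u v)
    (hσ : BottomRow N σ u v) :
    IsFormOf D N ((dirichletComp D Q.1 (Q'.1.act γ) B).act σ⁻¹) :=
  hσ.isFormOf h.neg (hB.isFormOf Q.2.one (Q'.2.one.act_one h.neg γ)) (h.gcd_eval_eq_one hB huv)

variable [IsFractionRing O K]

theorem exists_rayClass_mul (h : IsQuadOrder ι O D δ) (hN : 0 < N) (Q Q' : Forms D N) :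
    ∃ R : Forms D N, h.rayClass R = h.rayClass Q * h.rayClass Q' := by
  obtain ⟨γ, hγ⟩ := BinForm.exists_concordant Q.2.pos.ne' Q'.2.primitive
  obtain ⟨B, hB⟩ := BinForm.exists_isDirichletMiddle Q.2.disc_eq
    (Q'.2.one.act_one h.neg γ).disc_eq hγ
  obtain ⟨u, v, huv⟩ := h.exists_isUnitRelation hB
  obtain ⟨σ, hσ⟩ := h.exists_bottomRow hN hB huv
  exact ⟨_, h.rayClass_comp hγ hB huv hσ (h.isFormOf_composite hB huv hσ)⟩

/-- The map `[Q] ↦ [[ω_Q, 1]]`. -/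
noncomputable def classMap (h : IsQuadOrder ι O D δ) (N : ℕ) : FormClass D N → RayClassGroup O N :=
  Quotient.lift h.rayClass fun _ _ e => h.rayClass_eq_of_rel e

theorem classMap_injective (h : IsQuadOrder ι O D δ) : Function.Injective (h.classMap N) := by
  rintro ⟨Q⟩ ⟨Q'⟩ e
  exact (Quotient.sound (h.rel_of_rayClass_eq e)).symm

/-- The image contains the classes of integral ideals prime to `N`, which generate, and is closed
under products; being finite, it is also closed under inverses. -/
theorem classMap_surjective (h : IsQuadOrder ι O D δ) (hN : 0 < N) :
    Function.Surjective (h.classMap N) := by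
  have hfin := finite_formClass h.neg hN
  let J₁ : idealsPrimeTo O N := 1
  obtain ⟨Q₁, hQ₁⟩ := h.exists_rayClass_eq hN J₁ (𝔞 := ⊤) top_ne_bot (by simp) (by simp [J₁])
  let S : Submonoid (RayClassGroup O N) :=
    { carrier := Set.range (h.classMap N)
      one_mem' := ⟨FormClass.mk Q₁, hQ₁⟩
      mul_mem' := by
        rintro _ _ ⟨⟨Q⟩, rfl⟩ ⟨⟨Q'⟩, rfl⟩
        obtain ⟨R, hR⟩ := h.exists_rayClass_mul hN Q Q'
        exact ⟨FormClass.mk R, hR⟩ }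
  have hinv : ∀ x ∈ S, x⁻¹ ∈ S :=
    fun x hx => S.inv_mem_of_finite (Set.finite_range (h.classMap N)) hx
  suffices key : ∀ (I : IdealGroup O) (hI : I ∈ idealsPrimeTo O N),
      (QuotientGroup.mk ⟨I, hI⟩ : RayClassGroup O N) ∈ S by
    rintro ⟨I⟩
    exact key I.1 I.2
  intro I hI
  induction hI using Subgroup.closure_induction with
  | mem I hI =>
    obtain ⟨𝔞, h0, -, hco, e⟩ := id hI
    obtain ⟨Q, hQ⟩ := h.exists_rayClass_eq hN ⟨I, Subgroup.subset_closure hI⟩ h0 hco e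
    exact ⟨FormClass.mk Q, hQ⟩
  | one => exact S.one_mem
  | mul I J hI hJ h1 h2 => exact S.mul_mem h1 h2
  | inv I hI h1 => exact hinv _ h1

/-- The bijection between form classes and ray classes. -/
noncomputable def classEquiv (h : IsQuadOrder ι O D δ) (hN : 0 < N) :
    FormClass D N ≃ RayClassGroup O N :=
  Equiv.ofBijective (h.classMap N) ⟨h.classMap_injective, h.classMap_surjective hN⟩

end IsQuadOrder

end FormClassGroup

theorem theoremC {K : Type*} [Field K] [NumberField K] [NumberField.IsTotallyComplex K]
    (hK : Module.finrank ℚ K = 2) (ι : K →+* ℂ) (O : Subring K)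
    (hO : FormClassGroup.IsOrder O) (N : ℕ) (hN : 0 < N) :
    ∃ (_ : CommGroup (FormClassGroup.FormClass (FormClassGroup.orderDiscr O) N))
      (φ : FormClassGroup.FormClass (FormClassGroup.orderDiscr O) N ≃*
        FormClassGroup.RayClassGroup O N),
      FormClassGroup.IsCompositionLaw (FormClassGroup.orderDiscr O) N (fun C C' => C * C') ∧
      Finite (FormClassGroup.FormClass (FormClassGroup.orderDiscr O) N) ∧
      ∀ Q : FormClassGroup.Forms (FormClassGroup.orderDiscr O) N,
        ∃ I : FormClassGroup.idealsPrimeTo O N,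
          FormClassGroup.IsFormLattice ι O Q.1 (I.1 : FractionalIdeal O⁰ K) ∧
          φ (FormClassGroup.FormClass.mk Q) =
            (QuotientGroup.mk I : FormClassGroup.RayClassGroup O N) := by
  obtain ⟨δ, h⟩ := hO.exists_isQuadOrder hK ι
  have := h.isFractionRing
  -- With the group structure pulled back from ray classes, agreement with the composition recipe
  -- can be tested after applying the injective class map.
  let _ : CommGroup (FormClassGroup.FormClass (FormClassGroup.orderDiscr O) N) :=
    (h.classEquiv hN).commGroup
  refine ⟨inferInstance, (h.classEquiv hN).mulEquiv, ?_, FormClassGroup.finite_formClass h.neg hN, ?_⟩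
  · intro Q Q'
    refine ⟨FormClassGroup.BinForm.exists_concordant Q.2.pos.ne' Q'.2.primitive, fun γ hγ => ?_⟩
    refine ⟨FormClassGroup.BinForm.exists_isDirichletMiddle Q.2.disc_eq
      (Q'.2.one.act_one h.neg γ).disc_eq hγ, fun B hB => ?_⟩
    refine ⟨h.exists_isUnitRelation hB, fun u v huv => ?_⟩
    refine ⟨h.exists_bottomRow hN hB huv, fun σ hσ => ⟨h.isFormOf_composite hB huv hσ, ?_⟩⟩
    apply (h.classEquiv hN).injective
    have hmul := (h.classEquiv hN).mulEquiv.map_mul (FormClassGroup.FormClass.mk Q)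
      (FormClassGroup.FormClass.mk Q')
    exact (h.rayClass_comp hγ hB huv hσ (h.isFormOf_composite hB huv hσ)).trans hmul.symm
  · intro Q
    exact ⟨⟨h.formUnit Q.2.one, h.formUnit_mem Q.2⟩,
      ⟨Q.1.root δ, h.map_root Q.2.disc_eq, fun z => h.mem_formIdeal Q.2.one⟩, rfl⟩
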